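/- Let $m,n,k$ be positive integers with $k>m/2$, and let $\boldsymbol p_1,\dots,\boldsymbol p_n\in\mathbb R^m$ be pairwise distinct modulo $\mathbb Z^m$ (that is, $n$ distinct points of the torus $\mathbb T^m=\mathbb R^m/\mathbb Z^m$). For $\lambda>0$ put $$g_\lambda(\boldsymbol x)=\sum_{\boldsymbol l\in\mathbb Z^m}\frac{1}{1+\lambda\|\boldsymbol l\|_{2k}^{2k}}\cos(2\pi\,\boldsymbol l\cdot\boldsymbol x),\qquad \|\boldsymbol l\|_{2k}^{2k}=\sum_{i=1}^m|l_i|^{2k},$$ and let $G_\lambda=[g_\lambda(\boldsymbol p_i-\boldsymbol p_j)]_{1\le i,j\le n}$, a real symmetric matrix with eigenvalues $\rho_1(G_\lambda)\ge\rho_2(G_\lambda)\ge\dots\ge\rho_n(G_\lambda)$, counted with multiplicity. Then: 1. $G_\lambda$ is positive definite for every $\lambda>0$ (in particular for every $\lambda>1$). 2. Each eigenvalue is analytic in $1/\lambda$ at $\lambda=\infty$: for every $l$ there are real coefficients $a_{l0},a_{l1},a_{l2},\dots$, independent of $\lambda$, such that $$\rho_l(G_\lambda)=a_{l0}+\frac{a_{l1}}{\lambda}+\frac{a_{l2}}{\lambda^2}+\cdots$$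 (a convergent series) for all sufficiently large $\lambda$. 3. For any such expansion, $a_{10}=n$, $a_{l0}=0$ for $l=2,\dots,n$, and the first-order coefficients satisfy $a_{l1}>0$ for $l=2,\dots,n$. -/

import Mathlib

/-- The `2k`-th power of the `ℓ^{2k}` norm of an integer vector: `‖l‖_{2k}^{2k} = ∑ i, |l i| ^ (2k)`. -/
def powNorm {m : ℕ} (k : ℕ) (l : Fin m → ℤ) : ℝ :=
  ∑ i, |(l i : ℝ)| ^ (2 * k)

/-- The kernel `g_lam(x) = ∑_{l ∈ ℤ^m} cos (2π l·x) / (1 + lam ‖l‖_{2k}^{2k})`.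
The series converges absolutely for `lam > 0` and `k > m / 2`. -/
noncomputable def kernelG {m : ℕ} (k : ℕ) (lam : ℝ) (x : Fin m → ℝ) : ℝ :=
  ∑' l : Fin m → ℤ,
    1 / (1 + lam * powNorm k l) * Real.cos (2 * Real.pi * ∑ i, (l i : ℝ) * x i)

/-- The matrix `G_lam = [g_lam(p_i - p_j)]`. -/
noncomputable def matG {m n : ℕ} (k : ℕ) (p : Fin n → Fin m → ℝ) (lam : ℝ) :
    Matrix (Fin n) (Fin n) ℝ :=
  Matrix.of fun i j => kernelG k lam (p i - p j)

theorem kernelG_neg {m : ℕ} (k : ℕ) (lam : ℝ) (x : Fin m → ℝ) :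
    kernelG k lam (-x) = kernelG k lam x := by
  simp [kernelG]

theorem matG_isHermitian {m n : ℕ} (k : ℕ) (p : Fin n → Fin m → ℝ) (lam : ℝ) :
    (matG k p lam).IsHermitian := by
  ext i j
  simp only [Matrix.conjTranspose_apply, matG, Matrix.of_apply, star_trivial]
  rw [← kernelG_neg, neg_sub]

/-- The eigenvalues of `G_lam`, listed with multiplicity in descending order;
the index `l : Fin n` is zero-based, so `l = 0` is the largest eigenvalue. -/
noncomputable def rho {m n : ℕ} (k : ℕ) (p : Fin n → Fin m → ℝ) (l : Fin n) (lam : ℝ) : ℝ :=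
  (matG_isHermitian k p lam).eigenvalues₀ (Fin.cast (Fintype.card_fin n).symm l)

/-- `f` is, for all sufficiently large `lam`, the sum of the convergent power series
`a 0 + a 1 / lam + a 2 / lam ^ 2 + ⋯` in `1 / lam`. -/
def HasExpansionAtInfinity (f : ℝ → ℝ) (a : ℕ → ℝ) : Prop :=
  ∀ᶠ lam : ℝ in Filter.atTop, HasSum (fun r : ℕ => a r / lam ^ r) (f lam)

/-- The vectors `p i` represent pairwise distinct points of the torus `ℝ^m / ℤ^m`. -/
def DistinctOnTorus {m n : ℕ} (p : Fin n → Fin m → ℝ) : Prop :=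
  ∀ i j, i ≠ j → ¬ ∃ z : Fin m → ℤ, ∀ t, p i t - p j t = (z t : ℝ)

/-!
The quadratic form of `G_lam` at `x` is `∑ l, |∑ i, x i * exp (2πi l·(p i))| ^ 2` weighted by
`1 / (1 + lam ‖l‖_{2k}^{2k})`. Distinct points of the torus give distinct, hence linearly
independent, characters of `ℤ^m`, so some term is positive when `x ≠ 0`.

In the variable `t = 1 / lam` the entries of `G_lam` extend analytically through `t = 0`, so the
expansions come from Rellich's theorem: the eigenvalues of a one-parameter analytic family of
Hermitian matrices can be chosen analytic. It is a statement about the characteristic polynomials,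
which are real-rooted. Translate the variable to make the sum of the roots vanish; the second
coefficient is then minus half the sum of the squared roots. Unless all roots vanish identically,
it therefore vanishes to an even order `2 r`, and every root is `O(t ^ r)`. Dividing the roots by
`t ^ r` leaves an analytic family whose polynomial at `t = 0` has at least two distinct roots, so it
splits into coprime monic factors. Multiplication of monic polynomials has an invertible derivative
at a coprime pair, so the splitting extends analytically to nearby `t`, and one inducts on the
degree.

At `t = 0` all entries equal `1`. The trace of `G_lam` tends to `n`, while testing the form on the
all-ones vector shows that the largest eigenvalue is at least `n`; as the eigenvalues are positive,
this gives the constant terms. For `lam ≥ 1` the form of `lam G_lam` dominates, term by term, that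
of the positive definite matrix `G_1`, which bounds every `lam * rho_l` below by a positive
constant.
-/

open Polynomial Filter Topology
open scoped ContDiff

section CoeffAnalyticAt

variable {𝕜 E : Type*} [NontriviallyNormedField 𝕜] [NormedAddCommGroup E] [NormedSpace 𝕜 E]
  {P : E → 𝕜[X]} {t₀ : E}

/-- `P` is a family of polynomials whose coefficients are analytic functions of the parameter
near `t₀`. -/
def CoeffAnalyticAt (P : E → 𝕜[X]) (t₀ : E) : Prop :=
  ∀ i, AnalyticAt 𝕜 (fun t => (P t).coeff i) t₀

theorem CoeffAnalyticAt.taylor (hP : CoeffAnalyticAt P t₀) {n : ℕ}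
    (hdeg : ∀ᶠ t in 𝓝 t₀, (P t).natDegree ≤ n) {c : E → 𝕜} (hc : AnalyticAt 𝕜 c t₀) :
    CoeffAnalyticAt (fun t => Polynomial.taylor (c t) (P t)) t₀ := fun i => by
  have hsum : AnalyticAt 𝕜 (fun t => ∑ j ∈ Finset.range (n + 1),
      ((j + i).choose i : 𝕜) * (P t).coeff (j + i) * c t ^ j) t₀ :=
    Finset.analyticAt_fun_sum _ fun j _ =>
      (analyticAt_const.mul (hP (j + i))).mul (hc.pow j)
  refine hsum.congr (hdeg.mono fun t ht => ?_)
  have hlt : (hasseDeriv i (P t)).natDegree < n + 1 :=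
    (natDegree_hasseDeriv_le _ _).trans_lt (by lia)
  simp only [taylor_coeff, eval_eq_sum_range' hlt, hasseDeriv_coeff]

end CoeffAnalyticAt

section MonicOfFn

variable {𝕜 : Type*} [Field 𝕜] [DecidableEq 𝕜] {a b : ℕ}

/-- The monic polynomial of degree `a` whose lower coefficients are the entries of `u`. -/
noncomputable def monicOfFn (a : ℕ) (u : Fin a → 𝕜) : 𝕜[X] := X ^ a + ofFn a u

theorem degree_monicOfFn (u : Fin a → 𝕜) : (monicOfFn a u).degree = a := by
  rw [monicOfFn, degree_add_eq_left_of_degree_lt] <;> rw [degree_X_pow]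
  exact ofFn_degree_lt u

theorem isMonicOfDegree_monicOfFn (u : Fin a → 𝕜) : IsMonicOfDegree (monicOfFn a u) a :=
  ⟨natDegree_eq_of_degree_eq_some (degree_monicOfFn u), monic_X_pow_add (ofFn_degree_lt u)⟩

theorem coeff_monicOfFn (u : Fin a → 𝕜) (i : Fin a) : (monicOfFn a u).coeff i = u i := by
  rw [monicOfFn, coeff_add, coeff_X_pow, if_neg i.2.ne, zero_add, ofFn_coeff_eq_val_of_lt _ i.2]

theorem monicOfFn_toFn {p : 𝕜[X]} (hp : IsMonicOfDegree p a) : monicOfFn a (toFn a p) = p := by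
  have hmonic := isMonicOfDegree_monicOfFn (toFn a p)
  ext j
  rcases lt_or_ge j a with h | h
  · exact coeff_monicOfFn (toFn a p) ⟨j, h⟩
  · rw [hmonic.coeff_eq hp h]

theorem monicOfFn_add (u v : Fin a → 𝕜) : monicOfFn a (u + v) = monicOfFn a u + ofFn a v := by
  rw [monicOfFn, monicOfFn, map_add, add_assoc]

/-- The lower coefficients of the product of two monic polynomials, as a function of the lower
coefficients of the factors. -/
noncomputable def mulCoeffs (a b : ℕ) (w : (Fin a → 𝕜) × (Fin b → 𝕜)) : Fin (a + b) → 𝕜 :=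
  toFn (a + b) (monicOfFn a w.1 * monicOfFn b w.2)

theorem monicOfFn_mulCoeffs (w : (Fin a → 𝕜) × (Fin b → 𝕜)) :
    monicOfFn (a + b) (mulCoeffs a b w) = monicOfFn a w.1 * monicOfFn b w.2 :=
  monicOfFn_toFn ((isMonicOfDegree_monicOfFn _).mul (isMonicOfDegree_monicOfFn _))

theorem eq_zero_of_toFn_mul_add_mul_eq_zero {w h : (Fin a → 𝕜) × (Fin b → 𝕜)}
    (hw : IsCoprime (monicOfFn a w.1) (monicOfFn b w.2))
    (hh : toFn (a + b) (ofFn a h.1 * monicOfFn b w.2 + monicOfFn a w.1 * ofFn b h.2) = 0) :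
    h = 0 := by
  have hdeg : (ofFn a h.1 * monicOfFn b w.2 + monicOfFn a w.1 * ofFn b h.2).degree <
      ((a + b : ℕ) : WithBot ℕ) := by
    refine (degree_add_le _ _).trans_lt (max_lt ?_ ?_) <;>
      rw [degree_mul, degree_monicOfFn, Nat.cast_add]
    · exact WithBot.add_lt_add_right (by simp) (ofFn_degree_lt _)
    · exact WithBot.add_lt_add_left (by simp) (ofFn_degree_lt _)
  have hzero : ofFn a h.1 * monicOfFn b w.2 + monicOfFn a w.1 * ofFn b h.2 = 0 := by
    ext j
    by_cases hj : j < a + b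
    · exact congrFun hh ⟨j, hj⟩
    · exact coeff_eq_zero_of_degree_lt (hdeg.trans_le (by exact_mod_cast not_lt.1 hj))
  have hfst : ofFn a h.1 = 0 := by
    have hdvd : monicOfFn a w.1 ∣ ofFn a h.1 * monicOfFn b w.2 :=
      ⟨-ofFn b h.2, by rw [mul_neg]; exact eq_neg_of_add_eq_zero_left hzero⟩
    exact eq_zero_of_dvd_of_degree_lt (hw.dvd_of_dvd_mul_right hdvd)
      ((ofFn_degree_lt _).trans_eq (degree_monicOfFn _).symm)
  have hsnd : ofFn b h.2 = 0 := by
    rw [hfst, zero_mul, zero_add] at hzero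
    exact (mul_eq_zero.1 hzero).resolve_left (isMonicOfDegree_monicOfFn _).ne_zero
  exact Prod.ext (injective_ofFn a (by rw [hfst, Prod.fst_zero, map_zero]))
    (injective_ofFn b (by rw [hsnd, Prod.snd_zero, map_zero]))

end MonicOfFn

theorem coeffAnalyticAt_monicOfFn {𝕜 E : Type*} [NontriviallyNormedField 𝕜] [DecidableEq 𝕜]
    [NormedAddCommGroup E] [NormedSpace 𝕜 E] {n : ℕ} {u : E → Fin n → 𝕜} {t₀ : E}
    (hu : AnalyticAt 𝕜 u t₀) : CoeffAnalyticAt (fun t => monicOfFn n (u t)) t₀ := fun i => by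
  by_cases hi : i < n
  · simpa only [coeff_monicOfFn _ ⟨i, hi⟩] using analyticAt_pi_iff.1 hu ⟨i, hi⟩
  · simpa only [monicOfFn, coeff_add, ofFn_coeff_eq_zero_of_ge _ (not_lt.1 hi)] using
      analyticAt_const

section Hensel

variable {𝕜 : Type*} [RCLike 𝕜] {a b : ℕ}

theorem contDiff_monicOfFn_coeff [DecidableEq 𝕜] (j : ℕ) {n : WithTop ℕ∞} :
    ContDiff 𝕜 n fun u : Fin a → 𝕜 => (monicOfFn a u).coeff j := by
  simp only [monicOfFn, coeff_add]
  exact contDiff_const.add (lcoeff 𝕜 j ∘ₗ ofFn a).toContinuousLinearMap.contDiff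

theorem contDiff_mulCoeffs [DecidableEq 𝕜] {n : WithTop ℕ∞} :
    ContDiff 𝕜 n (mulCoeffs (𝕜 := 𝕜) a b) := by
  refine contDiff_pi.2 fun i => ?_
  simp only [mulCoeffs, toFn, LinearMap.pi_apply, lcoeff_apply, coeff_mul]
  exact ContDiff.sum fun j _ => ((contDiff_monicOfFn_coeff _).comp contDiff_fst).mul
    ((contDiff_monicOfFn_coeff _).comp contDiff_snd)

theorem fderiv_mulCoeffs_apply [DecidableEq 𝕜] (w h : (Fin a → 𝕜) × (Fin b → 𝕜)) :
    fderiv 𝕜 (mulCoeffs a b) w h =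
      toFn (a + b) (ofFn a h.1 * monicOfFn b w.2 + monicOfFn a w.1 * ofFn b h.2) := by
  set L := ofFn a h.1 * monicOfFn b w.2 + monicOfFn a w.1 * ofFn b h.2
  have hline : (fun s : 𝕜 => mulCoeffs a b (w + s • h)) = fun s => mulCoeffs a b w +
      s • toFn (a + b) L + s ^ 2 • toFn (a + b) (ofFn a h.1 * ofFn b h.2) := by
    ext1 s
    simp only [mulCoeffs, ← map_smul, ← map_add, Prod.fst_add, Prod.snd_add, Prod.smul_fst,
      Prod.smul_snd, monicOfFn_add, smul_eq_C_mul, L]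
    congr 1
    simp only [map_smul, smul_eq_C_mul, map_pow]
    ring
  have hderiv : HasDerivAt (fun s : 𝕜 => mulCoeffs a b (w + s • h)) (toFn (a + b) L) 0 := by
    rw [hline]
    simpa using (((hasDerivAt_id (0 : 𝕜)).smul_const (toFn (a + b) L)).const_add _).fun_add
      (((hasDerivAt_id (0 : 𝕜)).pow 2).smul_const (toFn (a + b) (ofFn a h.1 * ofFn b h.2)))
  exact ((contDiff_mulCoeffs.differentiable one_ne_zero w).hasFDerivAt.hasLineDerivAt h).unique
    hderiv

theorem fderiv_mulCoeffs_injective [DecidableEq 𝕜] {w : (Fin a → 𝕜) × (Fin b → 𝕜)}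
    (hw : IsCoprime (monicOfFn a w.1) (monicOfFn b w.2)) :
    Function.Injective (fderiv 𝕜 (mulCoeffs a b) w) :=
  (injective_iff_map_eq_zero _).2 fun h hh =>
    eq_zero_of_toFn_mul_add_mul_eq_zero hw (by rwa [← fderiv_mulCoeffs_apply])

theorem exists_contDiffAt_mulCoeffs_rightInverse [DecidableEq 𝕜] {w : (Fin a → 𝕜) × (Fin b → 𝕜)}
    (hw : IsCoprime (monicOfFn a w.1) (monicOfFn b w.2)) :
    ∃ ψ : (Fin (a + b) → 𝕜) → (Fin a → 𝕜) × (Fin b → 𝕜),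
      ContDiffAt 𝕜 ω ψ (mulCoeffs a b w) ∧
      ∀ᶠ c in 𝓝 (mulCoeffs a b w), mulCoeffs a b (ψ c) = c := by
  let e : ((Fin a → 𝕜) × (Fin b → 𝕜)) ≃L[𝕜] (Fin (a + b) → 𝕜) :=
    (LinearEquiv.ofInjectiveOfFinrankEq (fderiv 𝕜 (mulCoeffs a b) w).toLinearMap
      (fderiv_mulCoeffs_injective hw) (by simp)).toContinuousLinearEquiv
  have hfderiv : HasFDerivAt (mulCoeffs a b) (e : _ →L[𝕜] _) w :=
    (contDiff_mulCoeffs.differentiable one_ne_zero w).hasFDerivAt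
  have hcont : ContDiffAt 𝕜 ω (mulCoeffs (𝕜 := 𝕜) a b) w := contDiff_mulCoeffs.contDiffAt
  exact ⟨hcont.localInverse hfderiv (by simp), hcont.to_localInverse hfderiv (by simp),
    (hcont.hasStrictFDerivAt' hfderiv (by simp)).eventually_right_inverse⟩

variable {E : Type*} [NormedAddCommGroup E] [NormedSpace 𝕜 E] {P : E → 𝕜[X]} {t₀ : E}

theorem CoeffAnalyticAt.exists_mul_eq (hP : CoeffAnalyticAt P t₀)
    (hdeg : ∀ᶠ t in 𝓝 t₀, IsMonicOfDegree (P t) (a + b)) {q s : 𝕜[X]}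
    (hq : IsMonicOfDegree q a) (hs : IsMonicOfDegree s b) (hqs : IsCoprime q s)
    (hPqs : P t₀ = q * s) :
    ∃ Q S : E → 𝕜[X], CoeffAnalyticAt Q t₀ ∧ CoeffAnalyticAt S t₀ ∧
      (∀ t, IsMonicOfDegree (Q t) a) ∧ (∀ t, IsMonicOfDegree (S t) b) ∧
      ∀ᶠ t in 𝓝 t₀, P t = Q t * S t := by
  classical
  rw [← monicOfFn_toFn hq, ← monicOfFn_toFn hs] at hqs hPqs
  obtain ⟨ψ, hψ, hinv⟩ := exists_contDiffAt_mulCoeffs_rightInverse (w := (toFn a q, toFn b s)) hqs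
  have hbase : toFn (a + b) (P t₀) = mulCoeffs a b (toFn a q, toFn b s) := by rw [hPqs, mulCoeffs]
  rw [← hbase] at hψ hinv
  have hcoeffs : ContDiffAt 𝕜 ω (fun t => toFn (a + b) (P t)) t₀ :=
    contDiffAt_pi.2 fun i => (hP i).contDiffAt
  have hfactors : ContDiffAt 𝕜 ω (fun t => ψ (toFn (a + b) (P t))) t₀ := hψ.comp t₀ hcoeffs
  refine ⟨_, _, coeffAnalyticAt_monicOfFn hfactors.fst.analyticAt,
    coeffAnalyticAt_monicOfFn hfactors.snd.analyticAt,
    fun t => isMonicOfDegree_monicOfFn _, fun t => isMonicOfDegree_monicOfFn _, ?_⟩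
  filter_upwards [hdeg, hcoeffs.continuousAt.eventually hinv] with t ht htinv
  rw [← monicOfFn_mulCoeffs, htinv, monicOfFn_toFn ht]

end Hensel

section RootCoefficients

theorem multiset_sum_map_sq {R : Type*} [CommRing R] (s : Multiset R) :
    (s.map (· ^ 2)).sum = s.sum ^ 2 - 2 * s.esymm 2 := by
  induction s using Multiset.induction_on with
  | empty => simp [Multiset.esymm, Multiset.powersetCard_zero_right]
  | cons a s ih =>
    have hesymm : (a ::ₘ s).esymm 2 = s.esymm 2 + a * s.sum := by
      simp only [Multiset.esymm, Multiset.powersetCard_cons, Multiset.powersetCard_one,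
        Multiset.map_add, Multiset.map_map, Multiset.sum_add, Function.comp_def,
        Multiset.prod_cons, Multiset.prod_singleton]
      rw [Multiset.sum_map_mul_left, Multiset.map_id']
    rw [Multiset.map_cons, Multiset.sum_cons, Multiset.sum_cons, ih, hesymm]
    ring

variable {K : Type*} [Field K] {p : K[X]} {n : ℕ}

theorem sum_map_sq_roots (hp : IsMonicOfDegree p (n + 2)) (hsplits : p.Splits) :
    (p.roots.map (· ^ 2)).sum = p.coeff (n + 1) ^ 2 - 2 * p.coeff n := by
  have hsum : p.coeff (n + 1) = -p.roots.sum := by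
    rw [coeff_eq_esymm_roots_of_splits hsplits (by rw [hp.natDegree_eq]; lia), hp.natDegree_eq,
      hp.monic.leadingCoeff, show n + 2 - (n + 1) = 1 by lia]
    simp [Multiset.esymm, Multiset.powersetCard_one]
  have hesymm : p.coeff n = p.roots.esymm 2 := by
    rw [coeff_eq_esymm_roots_of_splits hsplits (by rw [hp.natDegree_eq]; lia), hp.natDegree_eq,
      hp.monic.leadingCoeff, Nat.add_sub_cancel_left]
    norm_num
  rw [hsum, hesymm, multiset_sum_map_sq, neg_sq]

theorem eq_X_pow_of_forall_roots_eq_zero (hp : IsMonicOfDegree p n) (hsplits : p.Splits)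
    (hroots : ∀ x ∈ p.roots, x = 0) : p = X ^ n := by
  rw [hsplits.eq_prod_roots_of_monic hp.monic, Multiset.eq_replicate.2 ⟨rfl, hroots⟩,
    ← hsplits.natDegree_eq_card_roots, hp.natDegree_eq]
  simp

theorem coeff_taylor_of_isMonicOfDegree (hp : IsMonicOfDegree p (n + 1)) (c : K) :
    (taylor c p).coeff n = p.coeff n + (n + 1) * c := by
  have hlt : (hasseDeriv n p).natDegree < 2 := by
    have := natDegree_hasseDeriv_le p n
    have := hp.natDegree_eq
    lia
  rw [taylor_coeff, eval_eq_sum_range' hlt, Finset.sum_range_succ, Finset.sum_range_one]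
  simp [hasseDeriv_coeff, add_comm 1 n, (isMonicOfDegree_iff p _).1 hp |>.2]

theorem coeff_eq_zero_of_eq_X_sub_C_pow [CharZero K] {μ : K} (hp : p = (X - C μ) ^ (n + 2))
    (hcoeff : p.coeff (n + 1) = 0) : p.coeff n = 0 := by
  rw [hp, sub_eq_add_neg, ← C_neg, coeff_X_add_C_pow, show n + 2 - (n + 1) = 1 by lia, pow_one,
    Nat.choose_succ_self_right, mul_eq_zero, neg_eq_zero, Nat.cast_eq_zero] at hcoeff
  have hμ : μ = 0 := hcoeff.resolve_right (by lia)
  simp [hp, hμ, coeff_X_pow]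

theorem exists_coprime_mul_eq_of_isRoot {μ : K} (hp : IsMonicOfDegree p n) (hμ : p.IsRoot μ)
    (hne : p ≠ (X - C μ) ^ n) :
    ∃ (a b : ℕ) (q s : K[X]), a < n ∧ b < n ∧ a + b = n ∧ IsMonicOfDegree q a ∧
      IsMonicOfDegree s b ∧ IsCoprime q s ∧ p = q * s := by
  obtain ⟨s, hps, hdvd⟩ := exists_eq_pow_rootMultiplicity_mul_and_not_dvd p hp.ne_zero μ
  set a := p.rootMultiplicity μ
  have hq : IsMonicOfDegree ((X - C μ) ^ a) a := by
    simpa using (isMonicOfDegree_X_sub_one μ).pow a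
  have hs : s.Monic := hq.monic.of_mul_monic_left (hps ▸ hp.monic)
  have hcop : IsCoprime ((X - C μ) ^ a) s :=
    IsCoprime.pow_left ((irreducible_X_sub_C μ).coprime_iff_not_dvd.2 hdvd)
  have hdeg : a + s.natDegree = n := by
    rw [← hp.natDegree_eq, hps, hq.monic.natDegree_mul hs, hq.natDegree_eq]
  have hapos : 0 < a := (rootMultiplicity_pos hp.ne_zero).2 hμ
  have hbpos : s.natDegree ≠ 0 := by
    intro h0
    rw [hs.natDegree_eq_zero.1 h0, mul_one] at hps
    exact hne (by rw [hps, ← hdeg, h0, add_zero])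
  exact ⟨a, s.natDegree, _, s, by lia, by lia, hdeg, hq, ⟨rfl, hs⟩, hcop, hps⟩

end RootCoefficients

section SplittingLimit

theorem abs_im_pow_le_norm_aeval {p : ℝ[X]} {n : ℕ} (hp : IsMonicOfDegree p n)
    (hsplits : p.Splits) (z : ℂ) : |z.im| ^ n ≤ ‖aeval z p‖ := by
  have hprod : ‖aeval z p‖ = (p.roots.map fun x : ℝ => ‖z - x‖).prod := by
    conv_lhs => rw [hsplits.eq_prod_roots_of_monic hp.monic]
    rw [map_multiset_prod, Multiset.map_map]
    change (normHom : ℂ →*₀ ℝ) _ = _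
    rw [map_multiset_prod, Multiset.map_map]
    exact congrArg Multiset.prod (Multiset.map_congr rfl fun x _ => by simp)
  calc |z.im| ^ n = (p.roots.map fun _ : ℝ => |z.im|).prod := by
        rw [Multiset.map_const', Multiset.prod_replicate, ← hsplits.natDegree_eq_card_roots,
          hp.natDegree_eq]
    _ ≤ (p.roots.map fun x : ℝ => ‖z - x‖).prod :=
        Multiset.prod_map_le_prod_map₀ _ _ (fun _ _ => abs_nonneg _) fun x _ => by
          simpa using Complex.abs_im_le_norm (z - x)
    _ = ‖aeval z p‖ := hprod.symm

theorem splits_of_tendsto_coeff {α : Type*} {l : Filter α} [l.NeBot] {P : α → ℝ[X]} {q : ℝ[X]}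
    {n : ℕ} (hlim : ∀ i, Tendsto (fun t => (P t).coeff i) l (𝓝 (q.coeff i)))
    (hP : ∀ᶠ t in l, IsMonicOfDegree (P t) n ∧ (P t).Splits) (hq : IsMonicOfDegree q n) :
    q.Splits := by
  refine Splits.of_splits_map (algebraMap ℝ ℂ) (IsAlgClosed.splits _) fun z hz => ?_
  have hn : n ≠ 0 := by
    rintro rfl
    simp [isMonicOfDegree_zero_iff.1 hq] at hz
  have hroot : aeval z q = 0 := by
    rw [← eval_map_algebraMap]
    exact isRoot_of_mem_roots hz
  have hsum {p : ℝ[X]} (hp : IsMonicOfDegree p n) :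
      aeval z p = ∑ i ∈ Finset.range (n + 1), p.coeff i • z ^ i :=
    aeval_eq_sum_range' (hp.natDegree_eq.trans_lt n.lt_succ_self) z
  have heval : Tendsto (fun t => ‖aeval z (P t)‖) l (𝓝 0) := by
    rw [← norm_zero (E := ℂ), ← hroot, hsum hq]
    exact (tendsto_finsetSum _ fun i _ => (hlim i).smul_const _).norm.congr'
      (hP.mono fun t ht => congrArg norm (hsum ht.1).symm)
  have him : |z.im| ^ n = 0 := le_antisymm
    (ge_of_tendsto heval (hP.mono fun t ht => abs_im_pow_le_norm_aeval ht.1 ht.2 z))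
    (by positivity)
  exact ⟨z.re, Complex.ext rfl (abs_eq_zero.1 ((pow_eq_zero_iff hn).1 him)).symm⟩

end SplittingLimit

section OrderOfVanishing

variable {𝕜 F : Type*} [NontriviallyNormedField 𝕜] [NormedAddCommGroup F] [NormedSpace 𝕜 F]

theorem exists_eventually_eq_pow_smul_of_norm_le {f : 𝕜 → F} {t₀ : 𝕜} (hf : AnalyticAt 𝕜 f t₀)
    {s : ℕ} {K : ℝ} (hK : ∀ᶠ t in 𝓝 t₀, ‖f t‖ ≤ K * ‖t - t₀‖ ^ s) :
    ∃ g : 𝕜 → F, AnalyticAt 𝕜 g t₀ ∧ ∀ᶠ t in 𝓝 t₀, f t = (t - t₀) ^ s • g t := by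
  rw [← natCast_le_analyticOrderAt hf]
  by_contra! hlt
  obtain ⟨d, hd⟩ := ENat.ne_top_iff_exists.1 hlt.ne_top
  rw [← hd, Nat.cast_lt] at hlt
  obtain ⟨g, hg, hg₀, hfg⟩ := hf.analyticOrderAt_eq_natCast.1 hd.symm
  have hbound : ∀ᶠ t in 𝓝[≠] t₀, ‖g t‖ ≤ K * ‖t - t₀‖ ^ (s - d) := by
    filter_upwards [self_mem_nhdsWithin, hK.filter_mono nhdsWithin_le_nhds,
      hfg.filter_mono nhdsWithin_le_nhds] with t ht hKt hfgt
    rw [hfgt, norm_smul, norm_pow, ← Nat.add_sub_of_le hlt.le, pow_add, mul_left_comm] at hKt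
    exact le_of_mul_le_mul_left hKt (pow_pos (norm_pos_iff.2 (sub_ne_zero.2 ht)) d)
  have hlim : Tendsto (fun t => K * ‖t - t₀‖ ^ (s - d)) (𝓝[≠] t₀) (𝓝 0) := by
    have hcont : ContinuousAt (fun t => K * ‖t - t₀‖ ^ (s - d)) t₀ := by fun_prop
    simpa [Nat.sub_ne_zero_of_lt hlt] using hcont.tendsto.mono_left nhdsWithin_le_nhds
  exact hg₀ (norm_le_zero_iff.1 (le_of_tendsto_of_tendsto
    (hg.continuousAt.norm.tendsto.mono_left nhdsWithin_le_nhds) hlim hbound))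

theorem eq_of_eventually_pow_smul_eq {f g : 𝕜 → F} {t₀ : 𝕜} (hf : ContinuousAt f t₀)
    (hg : ContinuousAt g t₀) {s : ℕ}
    (h : ∀ᶠ t in 𝓝 t₀, (t - t₀) ^ s • f t = (t - t₀) ^ s • g t) : f t₀ = g t₀ := by
  refine ((hf.eventuallyEq_nhds_iff_eventuallyEq_nhdsNE hg).1 ?_).eq_of_nhds
  filter_upwards [self_mem_nhdsWithin, h.filter_mono nhdsWithin_le_nhds] with t ht htfg
  exact smul_right_injective F (pow_ne_zero s (sub_ne_zero.2 ht)) htfg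

theorem eventually_eq_zero_or_exists_eq_pow_two_mul {f : ℝ → ℝ} {t₀ : ℝ}
    (hf : AnalyticAt ℝ f t₀) (hnonneg : ∀ᶠ t in 𝓝 t₀, 0 ≤ f t) :
    (∀ᶠ t in 𝓝 t₀, f t = 0) ∨ ∃ (r : ℕ) (u : ℝ → ℝ), AnalyticAt ℝ u t₀ ∧ 0 < u t₀ ∧
      ∀ᶠ t in 𝓝 t₀, f t = (t - t₀) ^ (2 * r) * u t := by
  by_cases htop : analyticOrderAt f t₀ = ⊤
  · exact Or.inl (analyticOrderAt_eq_top.1 htop)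
  right
  obtain ⟨d, hd⟩ := ENat.ne_top_iff_exists.1 htop
  obtain ⟨u, hu, hu₀, hfu⟩ := hf.analyticOrderAt_eq_natCast.1 hd.symm
  have hmul : ∀ᶠ t in 𝓝 t₀, 0 ≤ (t - t₀) ^ d * u t := by
    filter_upwards [hnonneg, hfu] with t ht hft
    rwa [hft] at ht
  have hpos : 0 < u t₀ := by
    refine hu₀.symm.lt_of_le (ge_of_tendsto (x := 𝓝[>] t₀)
      (hu.continuousAt.tendsto.mono_left nhdsWithin_le_nhds) ?_)
    filter_upwards [self_mem_nhdsWithin, hmul.filter_mono nhdsWithin_le_nhds] with t ht hmt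
    exact nonneg_of_mul_nonneg_right hmt (pow_pos (sub_pos.2 ht) d)
  have heven : Even d := by
    by_contra hodd
    rw [Nat.not_even_iff_odd] at hodd
    have hfalse : ∀ᶠ _ in 𝓝[<] t₀, False := by
      filter_upwards [self_mem_nhdsWithin, hmul.filter_mono nhdsWithin_le_nhds,
        (hu.continuousAt.eventually (lt_mem_nhds hpos)).filter_mono nhdsWithin_le_nhds]
        with t ht hmt hut
      exact hmt.not_gt (mul_neg_of_neg_of_pos (hodd.pow_neg (sub_neg.2 ht)) hut)
    exact hfalse.exists.elim fun _ h => h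
  obtain ⟨r, rfl⟩ := heven.exists_two_nsmul
  exact ⟨r, u, hu, hpos, hfu⟩

theorem eventually_nonneg_or_eventually_neg_nhdsGT {f : ℝ → ℝ} {t₀ : ℝ}
    (hf : AnalyticAt ℝ f t₀) : (∀ᶠ t in 𝓝[>] t₀, 0 ≤ f t) ∨ ∀ᶠ t in 𝓝[>] t₀, f t < 0 := by
  by_cases htop : analyticOrderAt f t₀ = ⊤
  · exact Or.inl (((analyticOrderAt_eq_top.1 htop).filter_mono nhdsWithin_le_nhds).mono
      fun t ht => ht.ge)
  obtain ⟨d, hd⟩ := ENat.ne_top_iff_exists.1 htop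
  obtain ⟨u, hu, hu₀, hfu⟩ := hf.analyticOrderAt_eq_natCast.1 hd.symm
  have hpow : ∀ᶠ t in 𝓝[>] t₀, 0 < (t - t₀) ^ d ∧ f t = (t - t₀) ^ d * u t := by
    filter_upwards [self_mem_nhdsWithin, hfu.filter_mono nhdsWithin_le_nhds] with t ht hft
    exact ⟨pow_pos (sub_pos.2 ht) d, hft⟩
  rcases hu₀.lt_or_gt with hneg | hpos
  · right
    filter_upwards [hpow, (hu.continuousAt.eventually (gt_mem_nhds hneg)).filter_mono
      nhdsWithin_le_nhds] with t ⟨ht, hft⟩ hut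
    exact hft ▸ mul_neg_of_pos_of_neg ht hut
  · left
    filter_upwards [hpow, (hu.continuousAt.eventually (lt_mem_nhds hpos)).filter_mono
      nhdsWithin_le_nhds] with t ⟨ht, hft⟩ hut
    exact hft ▸ (mul_pos ht hut).le

theorem exists_perm_eventually_antitone {n : ℕ} {f : Fin n → ℝ → ℝ} {t₀ : ℝ}
    (hf : ∀ i, AnalyticAt ℝ (f i) t₀) :
    ∃ σ : Equiv.Perm (Fin n), ∀ᶠ t in 𝓝[>] t₀, Antitone fun i => f (σ i) t := by
  have hcomparable (i j : Fin n) : ∀ᶠ s in 𝓝[>] t₀, f j s ≤ f i s →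
      ∀ᶠ t in 𝓝[>] t₀, f j t ≤ f i t := by
    rcases eventually_nonneg_or_eventually_neg_nhdsGT ((hf i).fun_sub (hf j)) with hle | hlt
    · exact Eventually.of_forall fun _ _ => hle.mono fun _ => sub_nonneg.1
    · exact hlt.mono fun _ hs hle => absurd hle (sub_neg.1 hs).not_ge
  obtain ⟨s, hs⟩ := (eventually_all.2 fun i => eventually_all.2 (hcomparable i)).exists
  refine ⟨Tuple.sort fun i => -f i s, ?_⟩
  simp only [Antitone, eventually_all]
  exact fun i j hij => hs _ _ (neg_le_neg_iff.1 (Tuple.monotone_sort (fun i => -f i s) hij))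

end OrderOfVanishing

section ScaleRoots

variable {𝕜 : Type*} [NontriviallyNormedField 𝕜] {P : 𝕜 → 𝕜[X]} {t₀ : 𝕜} {n r : ℕ}

theorem CoeffAnalyticAt.exists_eq_scaleRoots (hP : CoeffAnalyticAt P t₀)
    (hdeg : ∀ᶠ t in 𝓝 t₀, IsMonicOfDegree (P t) n) (hsplits : ∀ᶠ t in 𝓝 t₀, (P t).Splits) {B : ℝ}
    (hroots : ∀ᶠ t in 𝓝 t₀, ∀ x ∈ (P t).roots, ‖x‖ ≤ B * ‖t - t₀‖ ^ r) :
    ∃ R : 𝕜 → 𝕜[X], CoeffAnalyticAt R t₀ ∧ (∀ t, IsMonicOfDegree (R t) n) ∧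
      ∀ᶠ t in 𝓝 t₀, P t = (R t).scaleRoots ((t - t₀) ^ r) := by
  classical
  have hcoeff (j : Fin n) : ∃ b : 𝕜 → 𝕜, AnalyticAt 𝕜 b t₀ ∧
      ∀ᶠ t in 𝓝 t₀, (P t).coeff j = (t - t₀) ^ (r * (n - j)) • b t := by
    refine exists_eventually_eq_pow_smul_of_norm_le (hP j) (K := B ^ (n - j) * n.choose j) ?_
    filter_upwards [hdeg, hsplits, hroots] with t hdeg hsplits hroots
    have hle := coeff_le_of_roots_le (f := RingHom.id 𝕜) j hdeg.monic
      (by rwa [Polynomial.map_id]) (by rwa [Polynomial.map_id])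
    rw [Polynomial.map_id, hdeg.natDegree_eq, mul_pow, ← pow_mul] at hle
    linarith
  choose b hb hPb using hcoeff
  refine ⟨fun t => monicOfFn n fun j => b j t,
    coeffAnalyticAt_monicOfFn (analyticAt_pi_iff.2 hb), fun t => isMonicOfDegree_monicOfFn _, ?_⟩
  filter_upwards [hdeg, eventually_all.2 hPb] with t hdeg hPb
  have hR : IsMonicOfDegree (monicOfFn n fun j => b j t) n := isMonicOfDegree_monicOfFn _
  have hcoeffs : toFn n (P t) =
      toFn n ((monicOfFn n fun j => b j t).scaleRoots ((t - t₀) ^ r)) := by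
    ext j
    simp only [toFn, LinearMap.pi_apply, lcoeff_apply, coeff_scaleRoots, hR.natDegree_eq,
      coeff_monicOfFn, hPb j, ← pow_mul, smul_eq_mul, mul_comm]
  rw [← monicOfFn_toFn hdeg, hcoeffs, monicOfFn_toFn
    ⟨(natDegree_scaleRoots _ _).trans hR.natDegree_eq, (monic_scaleRoots_iff _).2 hR.monic⟩]

theorem splits_of_splits_scaleRoots {K : Type*} [Field K] {p : K[X]} {c : K} (hc : c ≠ 0)
    (hp : (p.scaleRoots c).Splits) : p.Splits := by
  rw [← scaleRoots_one p, ← mul_inv_cancel₀ hc, scaleRoots_mul]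
  exact hp.scaleRoots _

end ScaleRoots

section HyperbolicFamily

/-- `P` is an analytic family of hyperbolic polynomials near `t₀`: the `P t` are monic of degree
`n` with only real roots, and their coefficients depend analytically on `t`. -/
structure IsHyperbolicFamilyAt (P : ℝ → ℝ[X]) (n : ℕ) (t₀ : ℝ) : Prop where
  coeffAnalyticAt : CoeffAnalyticAt P t₀
  eventually_isMonicOfDegree : ∀ᶠ t in 𝓝 t₀, IsMonicOfDegree (P t) n
  eventually_splits : ∀ᶠ t in 𝓝 t₀, (P t).Splits

/-- Near `t₀`, the roots of `P t`, with multiplicity, are the values at `t` of functions analytic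
at `t₀`. -/
def HasAnalyticRootsAt (P : ℝ → ℝ[X]) (t₀ : ℝ) : Prop :=
  ∃ F : Multiset (ℝ → ℝ), (∀ f ∈ F, AnalyticAt ℝ f t₀) ∧
    ∀ᶠ t in 𝓝 t₀, P t = (F.map fun f => X - C (f t)).prod

variable {P Q R S : ℝ → ℝ[X]} {t₀ : ℝ} {n r : ℕ}

theorem HasAnalyticRootsAt.of_mul (hQ : HasAnalyticRootsAt Q t₀) (hS : HasAnalyticRootsAt S t₀)
    (h : ∀ᶠ t in 𝓝 t₀, P t = Q t * S t) : HasAnalyticRootsAt P t₀ := by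
  obtain ⟨F, hF, hQF⟩ := hQ
  obtain ⟨G, hG, hSG⟩ := hS
  refine ⟨F + G, fun f hf => (Multiset.mem_add.1 hf).elim (hF f) (hG f), ?_⟩
  filter_upwards [h, hQF, hSG] with t hP hQ hS
  rw [hP, hQ, hS, Multiset.map_add, Multiset.prod_add]

theorem HasAnalyticRootsAt.of_scaleRoots (hR : HasAnalyticRootsAt R t₀) {c : ℝ → ℝ}
    (hc : AnalyticAt ℝ c t₀) (h : ∀ᶠ t in 𝓝 t₀, P t = (R t).scaleRoots (c t)) :
    HasAnalyticRootsAt P t₀ := by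
  obtain ⟨F, hF, hRF⟩ := hR
  refine ⟨F.map fun f t => c t * f t, fun f hf => ?_, ?_⟩
  · obtain ⟨g, hg, rfl⟩ := Multiset.mem_map.1 hf
    exact hc.fun_mul (hF g hg)
  · filter_upwards [h, hRF] with t hP hR
    rw [hP, hR, Multiset.map_map]
    clear hF hRF hP hR
    induction F using Multiset.induction_on with
    | empty => simp
    | cons f F ih =>
      simp only [Multiset.map_cons, Multiset.prod_cons, mul_scaleRoots_of_noZeroDivisors, ih,
        X_sub_C_scaleRoots, Function.comp_apply, mul_comm (c t)]

theorem HasAnalyticRootsAt.of_taylor {c : ℝ → ℝ} (hc : AnalyticAt ℝ c t₀)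
    (h : HasAnalyticRootsAt (fun t => taylor (c t) (P t)) t₀) : HasAnalyticRootsAt P t₀ := by
  obtain ⟨F, hF, hPF⟩ := h
  refine ⟨F.map fun f t => f t + c t, fun f hf => ?_, ?_⟩
  · obtain ⟨g, hg, rfl⟩ := Multiset.mem_map.1 hf
    exact (hF g hg).fun_add hc
  · filter_upwards [hPF] with t ht
    have hP : P t = taylorAlgHom (-c t) (taylor (c t) (P t)) := by simp [taylor_taylor]
    rw [hP, ht, map_multiset_prod, Multiset.map_map, Multiset.map_map]
    refine congrArg Multiset.prod (Multiset.map_congr rfl fun f _ => ?_)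
    simp only [Function.comp_apply, taylorAlgHom_apply, map_sub, taylor_X, map_neg, taylor_C,
      map_add]
    ring

theorem IsHyperbolicFamilyAt.of_dvd (hP : IsHyperbolicFamilyAt P n t₀) {a : ℕ}
    (hQ : CoeffAnalyticAt Q t₀) (hdeg : ∀ t, IsMonicOfDegree (Q t) a)
    (hdvd : ∀ᶠ t in 𝓝 t₀, Q t ∣ P t) : IsHyperbolicFamilyAt Q a t₀ where
  coeffAnalyticAt := hQ
  eventually_isMonicOfDegree := Eventually.of_forall hdeg
  eventually_splits := by
    filter_upwards [hP.eventually_isMonicOfDegree, hP.eventually_splits, hdvd]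
      with t hdeg hsplits hdvd using hsplits.of_dvd hdeg.ne_zero hdvd

theorem IsHyperbolicFamilyAt.taylor (hP : IsHyperbolicFamilyAt P n t₀) {c : ℝ → ℝ}
    (hc : AnalyticAt ℝ c t₀) : IsHyperbolicFamilyAt (fun t => taylor (c t) (P t)) n t₀ where
  coeffAnalyticAt := hP.coeffAnalyticAt.taylor
    (hP.eventually_isMonicOfDegree.mono fun _ ht => ht.natDegree_eq.le) hc
  eventually_isMonicOfDegree := hP.eventually_isMonicOfDegree.mono fun _ ht =>
    ⟨(natDegree_taylor _ _).trans ht.natDegree_eq, (leadingCoeff_taylor _ _).trans ht.monic⟩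
  eventually_splits := hP.eventually_splits.mono fun _ ht => ht.taylor _

theorem IsHyperbolicFamilyAt.of_eq_scaleRoots (hP : IsHyperbolicFamilyAt P n t₀)
    (hR : CoeffAnalyticAt R t₀) (hdeg : ∀ t, IsMonicOfDegree (R t) n)
    (hscale : ∀ᶠ t in 𝓝 t₀, P t = (R t).scaleRoots ((t - t₀) ^ r)) :
    IsHyperbolicFamilyAt R n t₀ where
  coeffAnalyticAt := hR
  eventually_isMonicOfDegree := Eventually.of_forall hdeg
  eventually_splits := by
    have hne : ∀ᶠ t in 𝓝[≠] t₀, (R t).Splits := by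
      filter_upwards [self_mem_nhdsWithin, hP.eventually_splits.filter_mono nhdsWithin_le_nhds,
        hscale.filter_mono nhdsWithin_le_nhds] with t ht hsplits hscale
      exact splits_of_splits_scaleRoots (pow_ne_zero r (sub_ne_zero.2 ht)) (hscale ▸ hsplits)
    have hbase : (R t₀).Splits := splits_of_tendsto_coeff
      (fun i => (hR i).continuousAt.tendsto.mono_left nhdsWithin_le_nhds)
      (hne.mono fun t ht => ⟨hdeg t, ht⟩) (hdeg t₀)
    filter_upwards [eventually_nhdsWithin_iff.1 hne] with t ht
    rcases eq_or_ne t t₀ with rfl | h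
    exacts [hbase, ht h]

theorem IsHyperbolicFamilyAt.eventually_sq_le (hP : IsHyperbolicFamilyAt P (n + 2) t₀)
    (hcentred : ∀ᶠ t in 𝓝 t₀, (P t).coeff (n + 1) = 0) :
    ∀ᶠ t in 𝓝 t₀, 0 ≤ -2 * (P t).coeff n ∧ ∀ x ∈ (P t).roots, x ^ 2 ≤ -2 * (P t).coeff n := by
  filter_upwards [hP.eventually_isMonicOfDegree, hP.eventually_splits, hcentred]
    with t hdeg hsplits hcoeff
  have hsum : ((P t).roots.map (· ^ 2)).sum = -2 * (P t).coeff n := by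
    rw [sum_map_sq_roots hdeg hsplits, hcoeff]
    ring
  have hnonneg : ∀ y ∈ (P t).roots.map (· ^ 2), 0 ≤ y := by
    simp only [Multiset.mem_map, forall_exists_index, and_imp, forall_apply_eq_imp_iff₂]
    exact fun x _ => sq_nonneg x
  rw [← hsum]
  exact ⟨Multiset.sum_nonneg hnonneg,
    fun x hx => Multiset.single_le_sum hnonneg _ (Multiset.mem_map_of_mem (· ^ 2) hx)⟩

theorem coeff_eq_of_eventually_eq_scaleRoots {d : ℕ} {u : ℝ → ℝ}
    (hR : CoeffAnalyticAt R t₀) (hdeg : ∀ t, IsMonicOfDegree (R t) (n + d))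
    (hscale : ∀ᶠ t in 𝓝 t₀, P t = (R t).scaleRoots ((t - t₀) ^ r)) (hu : ContinuousAt u t₀)
    (hcoeff : ∀ᶠ t in 𝓝 t₀, (P t).coeff n = (t - t₀) ^ (r * d) * u t) :
    (R t₀).coeff n = u t₀ := by
  refine eq_of_eventually_pow_smul_eq (s := r * d) (hR n).continuousAt hu ?_
  filter_upwards [hscale, hcoeff] with t hscale hcoeff
  rw [smul_eq_mul, smul_eq_mul, ← hcoeff, hscale, coeff_scaleRoots, (hdeg t).natDegree_eq,
    Nat.add_sub_cancel_left, pow_mul, mul_comm]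

theorem IsHyperbolicFamilyAt.eventually_eq_X_pow_or_exists_scaleRoots
    (hP : IsHyperbolicFamilyAt P (n + 2) t₀)
    (hcentred : ∀ᶠ t in 𝓝 t₀, (P t).coeff (n + 1) = 0) :
    (∀ᶠ t in 𝓝 t₀, P t = X ^ (n + 2)) ∨
      ∃ (r : ℕ) (R : ℝ → ℝ[X]), IsHyperbolicFamilyAt R (n + 2) t₀ ∧ (R t₀).coeff (n + 1) = 0 ∧
        (R t₀).coeff n ≠ 0 ∧ ∀ᶠ t in 𝓝 t₀, P t = (R t).scaleRoots ((t - t₀) ^ r) := by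
  have hsq := hP.eventually_sq_le hcentred
  obtain hzero | ⟨r, u, hu, hpos, hcoeff⟩ := eventually_eq_zero_or_exists_eq_pow_two_mul
    (analyticAt_const.fun_mul (hP.coeffAnalyticAt n)) (hsq.mono fun t ht => ht.1)
  · left
    filter_upwards [hP.eventually_isMonicOfDegree, hP.eventually_splits, hsq, hzero]
      with t hdeg hsplits hsq hzero
    refine eq_X_pow_of_forall_roots_eq_zero hdeg hsplits fun x hx => ?_
    exact pow_eq_zero_iff two_ne_zero |>.1 ((hzero ▸ hsq.2 x hx).antisymm (sq_nonneg x))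
  right
  have hroots : ∀ᶠ t in 𝓝 t₀, ∀ x ∈ (P t).roots, ‖x‖ ≤ √(u t₀ + 1) * ‖t - t₀‖ ^ r := by
    filter_upwards [hsq, hcoeff, hu.continuousAt.eventually (gt_mem_nhds (lt_add_one (u t₀)))]
      with t hsq hcoeff hut x hx
    refine abs_le_of_sq_le_sq ?_ (by positivity)
    calc x ^ 2 ≤ (t - t₀) ^ (2 * r) * u t := hcoeff ▸ hsq.2 x hx
      _ ≤ (t - t₀) ^ (2 * r) * (u t₀ + 1) :=
        mul_le_mul_of_nonneg_left hut.le ((even_two_mul r).pow_nonneg _)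
      _ = (√(u t₀ + 1) * ‖t - t₀‖ ^ r) ^ 2 := by
        rw [mul_pow, Real.sq_sqrt (by positivity), ← pow_mul, mul_comm r, pow_mul ‖t - t₀‖,
          Real.norm_eq_abs, sq_abs, ← pow_mul, mul_comm]
  obtain ⟨R, hR, hdeg, hscale⟩ := hP.coeffAnalyticAt.exists_eq_scaleRoots
    hP.eventually_isMonicOfDegree hP.eventually_splits hroots
  have hnext : (R t₀).coeff (n + 1) = 0 :=
    coeff_eq_of_eventually_eq_scaleRoots (d := 1) (u := fun _ => 0) hR hdeg hscale
      continuousAt_const (hcentred.mono fun t ht => by rw [ht, mul_zero])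
  have hsecond : (R t₀).coeff n = -u t₀ / 2 :=
    coeff_eq_of_eventually_eq_scaleRoots (d := 2) (u := fun t => -u t / 2) hR hdeg hscale
      (hu.continuousAt.neg.div_const 2) (hcoeff.mono fun t ht => by
        rw [mul_comm r]
        linarith)
  exact ⟨r, R, hP.of_eq_scaleRoots hR hdeg hscale, hnext, by rw [hsecond]; linarith, hscale⟩

theorem IsHyperbolicFamilyAt.exists_mul_eq (hP : IsHyperbolicFamilyAt P (n + 2) t₀)
    (hnext : (P t₀).coeff (n + 1) = 0) (hsecond : (P t₀).coeff n ≠ 0) :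
    ∃ (a b : ℕ) (Q S : ℝ → ℝ[X]), a < n + 2 ∧ b < n + 2 ∧ IsHyperbolicFamilyAt Q a t₀ ∧
      IsHyperbolicFamilyAt S b t₀ ∧ ∀ᶠ t in 𝓝 t₀, P t = Q t * S t := by
  have hdeg : IsMonicOfDegree (P t₀) (n + 2) := hP.eventually_isMonicOfDegree.self_of_nhds
  obtain ⟨μ, hμ⟩ := hP.eventually_splits.self_of_nhds.exists_eval_eq_zero
    (degree_ne_of_natDegree_ne (n := 0) (by rw [hdeg.natDegree_eq]; lia))
  obtain ⟨a, b, q, s, ha, hb, hab, hq, hs, hcop, hqs⟩ := exists_coprime_mul_eq_of_isRoot hdeg hμ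
    fun hpow => hsecond (coeff_eq_zero_of_eq_X_sub_C_pow hpow hnext)
  obtain ⟨Q, S, hQ, hS, hQdeg, hSdeg, hPQS⟩ := hP.coeffAnalyticAt.exists_mul_eq
    (by rw [hab]; exact hP.eventually_isMonicOfDegree) hq hs hcop hqs
  exact ⟨a, b, Q, S, ha, hb,
    hP.of_dvd hQ hQdeg (hPQS.mono fun t ht => ht ▸ dvd_mul_right _ _),
    hP.of_dvd hS hSdeg (hPQS.mono fun t ht => ht ▸ dvd_mul_left _ _), hPQS⟩

theorem IsHyperbolicFamilyAt.exists_taylor_centred (hP : IsHyperbolicFamilyAt P (n + 1) t₀) :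
    ∃ c : ℝ → ℝ, AnalyticAt ℝ c t₀ ∧
      ∀ᶠ t in 𝓝 t₀, (Polynomial.taylor (c t) (P t)).coeff n = 0 := by
  refine ⟨fun t => -(P t).coeff n / (n + 1),
    (hP.coeffAnalyticAt n).fun_neg.fun_div analyticAt_const (by positivity), ?_⟩
  filter_upwards [hP.eventually_isMonicOfDegree] with t hdeg
  rw [coeff_taylor_of_isMonicOfDegree hdeg]
  field_simp
  ring

theorem IsHyperbolicFamilyAt.hasAnalyticRootsAt (hP : IsHyperbolicFamilyAt P n t₀) :
    HasAnalyticRootsAt P t₀ := by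
  induction n using Nat.strong_induction_on generalizing P with
  | _ n ih =>
  match n, ih with
  | 0, _ =>
    refine ⟨0, by simp, hP.eventually_isMonicOfDegree.mono fun t ht => ?_⟩
    simpa using isMonicOfDegree_zero_iff.1 ht
  | 1, _ =>
    refine ⟨{fun t => -(P t).coeff 0}, by simpa using (hP.coeffAnalyticAt 0).fun_neg,
      hP.eventually_isMonicOfDegree.mono fun t ht => ?_⟩
    obtain ⟨x, hx⟩ := isMonicOfDegree_one_iff.1 ht
    simp [hx]
  | n + 2, ih =>
    obtain ⟨c, hc, hcentred⟩ := hP.exists_taylor_centred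
    refine HasAnalyticRootsAt.of_taylor hc ?_
    obtain hpow | ⟨r, R, hR, hnext, hsecond, hscale⟩ :=
      (hP.taylor hc).eventually_eq_X_pow_or_exists_scaleRoots hcentred
    · exact ⟨Multiset.replicate (n + 2) fun _ => 0,
        fun f hf => Multiset.eq_of_mem_replicate hf ▸ analyticAt_const,
        hpow.mono fun t ht => by
          simp only [ht, Multiset.map_replicate, Multiset.prod_replicate, C_0, sub_zero]⟩
    obtain ⟨a, b, Q, S, ha, hb, hQ, hS, hRQS⟩ := hR.exists_mul_eq hnext hsecond
    exact ((ih a ha hQ).of_mul (ih b hb hS) hRQS).of_scaleRoots (by fun_prop) hscale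

end HyperbolicFamily

section Eigenvalues

theorem eq_of_antitone_of_prod_X_sub_C_eq {R : Type*} [CommRing R] [IsDomain R] [LinearOrder R]
    {n : ℕ} {f g : Fin n → R} (hf : Antitone f) (hg : Antitone g)
    (h : ∏ i, (X - C (f i)) = ∏ i, (X - C (g i))) : f = g := by
  have hroots (u : Fin n → R) : (∏ i, (X - C (u i))).roots = (List.ofFn u : Multiset R) := by
    rw [roots_prod _ _ (Finset.prod_ne_zero_iff.2 fun i _ => X_sub_C_ne_zero _)]
    simp [← Fin.univ_val_map]
  have hperm : (List.ofFn f).Perm (List.ofFn g) := by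
    rw [← Multiset.coe_eq_coe, ← hroots, ← hroots, h]
  exact List.ofFn_injective
    (hperm.eq_of_pairwise' hf.sortedGE_ofFn.pairwise hg.sortedGE_ofFn.pairwise)

theorem HasAnalyticRootsAt.exists_eventually_antitone {P : ℝ → ℝ[X]} {t₀ : ℝ} {n : ℕ}
    (hP : HasAnalyticRootsAt P t₀) (hdeg : (P t₀).natDegree = n) :
    ∃ f : Fin n → ℝ → ℝ, (∀ i, AnalyticAt ℝ (f i) t₀) ∧
      ∀ᶠ t in 𝓝[>] t₀, Antitone (fun i => f i t) ∧ P t = ∏ i, (X - C (f i t)) := by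
  obtain ⟨F, hF, hPF⟩ := hP
  obtain ⟨L, rfl⟩ := Quot.exists_rep F
  have hprod : ∀ᶠ t in 𝓝 t₀, P t = ∏ i : Fin L.length, (X - C (L.get i t)) := by
    filter_upwards [hPF] with t ht
    rw [ht, ← Fin.prod_ofFn]
    exact congrArg List.prod (List.ofFn_getElem_eq_map L _).symm
  obtain rfl : L.length = n := by
    rw [← hdeg, hprod.self_of_nhds, natDegree_finsetProd_X_sub_C_eq_card, Finset.card_univ,
      Fintype.card_fin]
  have hanalytic (i : Fin L.length) : AnalyticAt ℝ (L.get i) t₀ := hF _ (L.get_mem i)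
  obtain ⟨σ, hσ⟩ := exists_perm_eventually_antitone hanalytic
  refine ⟨fun i => L.get (σ i), fun i => hanalytic (σ i), ?_⟩
  filter_upwards [hσ, hprod.filter_mono nhdsWithin_le_nhds] with t hσt ht
  exact ⟨hσt, ht.trans (Equiv.prod_comp σ fun i => X - C (L.get i t)).symm⟩

variable {𝕜 ι : Type*} [RCLike 𝕜] [Fintype ι] [DecidableEq ι]

theorem analyticAt_coeff_charpoly {K E B : Type*} [NontriviallyNormedField K] [NormedCommRing B]
    [NormedAlgebra K B] [NormedAddCommGroup E] [NormedSpace K E] {H : E → Matrix ι ι B} {t₀ : E}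
    (hH : ∀ i j, AnalyticAt K (fun t => H t i j) t₀) (r : ℕ) :
    AnalyticAt K (fun t => (H t).charpoly.coeff r) t₀ := by
  have h := AnalyticAt.aeval_mvPolynomial (A := ℤ) (fun ij : ι × ι => hH ij.1 ij.2)
    ((Matrix.charpoly.univ ℤ ι).coeff r)
  refine h.congr (Eventually.of_forall fun t => ?_)
  exact Matrix.charpoly.univ_coeff_eval₂Hom ι (algebraMap ℤ B) (fun ij => H t ij.1 ij.2) r

theorem charpoly_eq_map_prod_eigenvalues₀ {A : Matrix ι ι 𝕜} (hA : A.IsHermitian) :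
    A.charpoly = (∏ i, (X - C (hA.eigenvalues₀ i))).map (algebraMap ℝ 𝕜) := by
  rw [hA.charpoly_eq, Polynomial.map_prod,
    ← Equiv.prod_comp (Fintype.equivOfCardEq (Fintype.card_fin (Fintype.card ι)))]
  simp [Matrix.IsHermitian.eigenvalues]

theorem isHyperbolicFamilyAt_prod_eigenvalues₀ {H : ℝ → Matrix ι ι 𝕜} {t₀ : ℝ}
    (hH : ∀ i j, AnalyticAt ℝ (fun t => H t i j) t₀) (hherm : ∀ t, (H t).IsHermitian) :
    IsHyperbolicFamilyAt (fun t => ∏ i, (X - C ((hherm t).eigenvalues₀ i))) (Fintype.card ι) t₀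
    where
  coeffAnalyticAt r := by
    refine (RCLike.reCLM.analyticAt _).comp (analyticAt_coeff_charpoly hH r) |>.congr
      (Eventually.of_forall fun t => ?_)
    simp only [Function.comp_apply, charpoly_eq_map_prod_eigenvalues₀ (hherm t), coeff_map,
      RCLike.algebraMap_eq_ofReal, RCLike.reCLM_apply, RCLike.ofReal_re]
  eventually_isMonicOfDegree := Eventually.of_forall fun t =>
    ⟨by simp, monic_prod_X_sub_C _ _⟩
  eventually_splits := Eventually.of_forall fun t => Splits.prod fun i _ => Splits.X_sub_C _

theorem exists_analyticAt_eventually_eigenvalues₀_eq {H : ℝ → Matrix ι ι 𝕜} {t₀ : ℝ}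
    (hH : ∀ i j, AnalyticAt ℝ (fun t => H t i j) t₀) (hherm : ∀ t, (H t).IsHermitian) :
    ∃ f : Fin (Fintype.card ι) → ℝ → ℝ, (∀ l, AnalyticAt ℝ (f l) t₀) ∧
      ∀ᶠ t in 𝓝[>] t₀, ∀ l, (hherm t).eigenvalues₀ l = f l t := by
  have hfamily := isHyperbolicFamilyAt_prod_eigenvalues₀ hH hherm
  obtain ⟨f, hf, hanti⟩ := hfamily.hasAnalyticRootsAt.exists_eventually_antitone
    hfamily.eventually_isMonicOfDegree.self_of_nhds.natDegree_eq
  refine ⟨f, hf, hanti.mono fun t ⟨hft, hprod⟩ => ?_⟩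
  exact congrFun (eq_of_antitone_of_prod_X_sub_C_eq (hherm t).eigenvalues₀_antitone hft hprod)

end Eigenvalues

section SpectralBounds

open scoped ComplexOrder MatrixOrder

variable {𝕜 ι : Type*} [RCLike 𝕜] [Fintype ι]

theorem posSemidef_iff_forall_re_nonneg {A : Matrix ι ι 𝕜} (hA : A.IsHermitian) :
    A.PosSemidef ↔ ∀ x, 0 ≤ RCLike.re (star x ⬝ᵥ (A.mulVec x)) := by
  refine ⟨fun h x => h.re_dotProduct_nonneg x, fun h => ?_⟩
  refine .of_dotProduct_mulVec_nonneg hA fun x => ?_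
  exact RCLike.nonneg_iff.2 ⟨h x, hA.im_star_dotProduct_mulVec_self x⟩

variable [DecidableEq ι] {A : Matrix ι ι 𝕜}

theorem spectrum_real_eq_range_eigenvalues₀ (hA : A.IsHermitian) :
    spectrum ℝ A = Set.range hA.eigenvalues₀ :=
  hA.spectrum_real_eq_range_eigenvalues.trans (EquivLike.range_comp hA.eigenvalues₀ _)

theorem forall_le_eigenvalues₀_iff (hA : A.IsHermitian) {c : ℝ} :
    (∀ l, c ≤ hA.eigenvalues₀ l) ↔
      ∀ x, c * RCLike.re (star x ⬝ᵥ x) ≤ RCLike.re (star x ⬝ᵥ (A.mulVec x)) := by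
  have hself : IsSelfAdjoint A := hA
  have hsub : (A - algebraMap ℝ _ c).IsHermitian :=
    hself.sub (IsSelfAdjoint.algebraMap _ (.all c))
  rw [← Set.forall_mem_range (p := (c ≤ ·)), ← spectrum_real_eq_range_eigenvalues₀ hA,
    ← algebraMap_le_iff_le_spectrum hself, Matrix.le_iff, posSemidef_iff_forall_re_nonneg hsub]
  refine forall_congr' fun x => ?_
  rw [← sub_nonneg]
  simp [Matrix.sub_mulVec, Algebra.algebraMap_eq_smul_one, Matrix.smul_mulVec, dotProduct_smul,
    RCLike.smul_re]

theorem forall_eigenvalues₀_le_iff (hA : A.IsHermitian) {c : ℝ} :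
    (∀ l, hA.eigenvalues₀ l ≤ c) ↔
      ∀ x, RCLike.re (star x ⬝ᵥ (A.mulVec x)) ≤ c * RCLike.re (star x ⬝ᵥ x) := by
  have hself : IsSelfAdjoint A := hA
  have hsub : (algebraMap ℝ _ c - A).IsHermitian :=
    (IsSelfAdjoint.algebraMap _ (.all c)).sub hself
  rw [← Set.forall_mem_range (p := (· ≤ c)), ← spectrum_real_eq_range_eigenvalues₀ hA,
    ← le_algebraMap_iff_spectrum_le hself, Matrix.le_iff, posSemidef_iff_forall_re_nonneg hsub]
  refine forall_congr' fun x => ?_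
  rw [← sub_nonneg (a := c * _)]
  simp [Matrix.sub_mulVec, Algebra.algebraMap_eq_smul_one, Matrix.smul_mulVec, dotProduct_smul,
    RCLike.smul_re]

theorem exists_pos_forall_le_eigenvalues₀ (hA : A.PosDef) :
    ∃ c : ℝ, 0 < c ∧ ∀ l, c ≤ hA.isHermitian.eigenvalues₀ l := by
  have hpos : ∀ l, 0 < hA.isHermitian.eigenvalues₀ l := by
    have hrange := spectrum_real_eq_range_eigenvalues₀ hA.isHermitian
    rw [hA.isHermitian.spectrum_real_eq_range_eigenvalues] at hrange
    rw [← Set.forall_mem_range (p := (0 < ·)), ← hrange, Set.forall_mem_range]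
    exact hA.eigenvalues_pos
  rcases isEmpty_or_nonempty (Fin (Fintype.card ι)) with h | h
  · exact ⟨1, one_pos, h.elim⟩
  · obtain ⟨l, hl⟩ := Finite.exists_min hA.isHermitian.eigenvalues₀
    exact ⟨_, hpos l, hl⟩

theorem trace_eq_sum_eigenvalues₀ (hA : A.IsHermitian) :
    A.trace = ∑ l, (hA.eigenvalues₀ l : 𝕜) := by
  rw [hA.trace_eq_sum_eigenvalues,
    ← Equiv.sum_comp (Fintype.equivOfCardEq (Fintype.card_fin (Fintype.card ι)))]
  simp [Matrix.IsHermitian.eigenvalues]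

end SpectralBounds

section LatticeSums

variable {m k : ℕ}

theorem powNorm_zero (hk : k ≠ 0) : powNorm k (0 : Fin m → ℤ) = 0 := by
  simp [powNorm, hk]

theorem powNorm_nonneg (k : ℕ) (l : Fin m → ℤ) : 0 ≤ powNorm k l :=
  Finset.sum_nonneg fun _ _ => by positivity

theorem abs_pow_le_powNorm (k : ℕ) (l : Fin m → ℤ) (i : Fin m) :
    |(l i : ℝ)| ^ (2 * k) ≤ powNorm k l :=
  Finset.single_le_sum (f := fun i => |(l i : ℝ)| ^ (2 * k)) (fun _ _ => by positivity)
    (Finset.mem_univ i)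

theorem norm_pow_le_powNorm (hk : k ≠ 0) (l : Fin m → ℤ) :
    ‖fun i => (l i : ℝ)‖ ^ (2 * k) ≤ powNorm k l := by
  rcases isEmpty_or_nonempty (Fin m) with hm | hm
  · rw [Subsingleton.elim (fun i => (l i : ℝ)) 0, norm_zero, zero_pow (by positivity)]
    exact powNorm_nonneg k l
  · obtain ⟨i, hi⟩ := Finite.exists_max fun i => ‖(l i : ℝ)‖
    have hnorm : ‖fun i => (l i : ℝ)‖ ≤ ‖(l i : ℝ)‖ :=
      (pi_norm_le_iff_of_nonneg (norm_nonneg _)).2 hi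
    exact (pow_le_pow_left₀ (norm_nonneg _) hnorm _).trans (abs_pow_le_powNorm k l i)

theorem one_le_powNorm (k : ℕ) {l : Fin m → ℤ} (hl : l ≠ 0) : 1 ≤ powNorm k l := by
  obtain ⟨i, hi⟩ := Function.ne_iff.1 hl
  refine le_trans (one_le_pow₀ ?_) (abs_pow_le_powNorm k l i)
  exact_mod_cast Int.one_le_abs hi

theorem summable_inv_norm_pow {r : ℕ} (hr : m < r) :
    Summable fun l : Fin m → ℤ => (‖fun i => (l i : ℝ)‖ ^ r)⁻¹ := by
  let L : Submodule ℤ (Fin m → ℝ) := Submodule.span ℤ (Set.range (Pi.basisFun ℝ (Fin m)))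
  have hrank : Module.finrank ℤ L = m := by
    rw [ZLattice.rank ℝ L, Module.finrank_fin_fun]
  have hmem : ∀ l : Fin m → ℤ, (fun i => (l i : ℝ)) ∈ L := fun l =>
    ((Pi.basisFun ℝ (Fin m)).mem_span_iff_repr_mem ℤ _).2 fun i => ⟨l i, by simp⟩
  let toLattice : (Fin m → ℤ) → L := fun l => ⟨fun i => (l i : ℝ), hmem l⟩
  have hinj : Function.Injective toLattice := fun l l' h =>
    funext fun i => Int.cast_injective (congrFun (congrArg Subtype.val h) i)
  refine ((ZLattice.summable_norm_pow_inv L r (by rwa [hrank])).comp_injective hinj).congr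
    fun l => ?_
  exact inv_pow _ _

theorem summable_inv_powNorm (hk : m < 2 * k) :
    Summable fun l : Fin m → ℤ => (powNorm k l)⁻¹ := by
  have hk0 : k ≠ 0 := by omega
  refine (summable_inv_norm_pow hk).of_nonneg_of_le (fun l => inv_nonneg.2 (powNorm_nonneg k l))
    fun l => ?_
  rcases eq_or_ne l 0 with rfl | hl
  · rw [powNorm_zero hk0, inv_zero]
    positivity
  · refine inv_anti₀ (pow_pos (norm_pos_iff.2 fun h => hl (funext fun i => ?_)) _)
      (norm_pow_le_powNorm hk0 l)
    simpa using congrFun h i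

theorem summable_one_div_one_add_mul_powNorm (hk : m < 2 * k) {lam : ℝ} (hlam : 0 < lam) :
    Summable fun l : Fin m → ℤ => 1 / (1 + lam * powNorm k l) := by
  refine ((summable_inv_powNorm hk).mul_left lam⁻¹).of_norm_bounded_eventually ?_
  refine (Set.finite_singleton 0).eventually_cofinite_notMem.mono fun l hl => ?_
  have hnorm := one_le_powNorm k hl
  rw [Real.norm_of_nonneg (by positivity), ← mul_inv, one_div]
  gcongr
  linarith

end LatticeSums

section FourierForm

variable {m n k : ℕ} {p : Fin n → Fin m → ℝ}

/-- The phase `2π l·x` of the character `l` of the torus at the point `x`. -/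
noncomputable def phase (l : Fin m → ℤ) (x : Fin m → ℝ) : ℝ :=
  2 * Real.pi * ∑ i, (l i : ℝ) * x i

theorem phase_sub (l : Fin m → ℤ) (x y : Fin m → ℝ) :
    phase l (x - y) = phase l x - phase l y := by
  simp only [phase, Pi.sub_apply, mul_sub, Finset.sum_sub_distrib]

theorem phase_neg (l : Fin m → ℤ) (x : Fin m → ℝ) : phase l (-x) = -phase l x := by
  simp [phase]

theorem phase_zero_left (x : Fin m → ℝ) : phase (0 : Fin m → ℤ) x = 0 := by
  simp [phase]

theorem phase_add_left (l l' : Fin m → ℤ) (x : Fin m → ℝ) :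
    phase (l + l') x = phase l x + phase l' x := by
  simp only [phase, Pi.add_apply, Int.cast_add, add_mul, Finset.sum_add_distrib, mul_add]

theorem phase_single (t : Fin m) (x : Fin m → ℝ) :
    phase (Pi.single t 1) x = 2 * Real.pi * x t := by
  simp [phase, Pi.single_apply]

/-- The character `l ↦ exp (2πi l·x)` of `ℤ^m` given by a point `x` of the torus. -/
noncomputable def torusChar (x : Fin m → ℝ) : Multiplicative (Fin m → ℤ) →* ℂ where
  toFun l := Complex.exp (phase l.toAdd x * Complex.I)
  map_one' := by simp [phase_zero_left]
  map_mul' a b := by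
    rw [toAdd_mul, phase_add_left, Complex.ofReal_add, add_mul, Complex.exp_add]

theorem torusChar_ofAdd (x : Fin m → ℝ) (l : Fin m → ℤ) :
    torusChar x (Multiplicative.ofAdd l) =
      (Real.cos (phase l x) : ℂ) + (Real.sin (phase l x) : ℂ) * Complex.I := by
  simp [torusChar, Complex.exp_mul_I]

theorem exists_int_sub_eq_of_torusChar_eq {x y : Fin m → ℝ} (h : torusChar x = torusChar y)
    (t : Fin m) : ∃ z : ℤ, x t - y t = z := by
  have hexp : Complex.exp (phase (Pi.single t 1) x * Complex.I) =
      Complex.exp (phase (Pi.single t 1) y * Complex.I) :=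
    DFunLike.congr_fun h (Multiplicative.ofAdd (Pi.single t 1))
  rw [phase_single, phase_single] at hexp
  obtain ⟨z, hz⟩ := Complex.exp_eq_exp_iff_exists_int.1 hexp
  have hmul : (2 * Real.pi * Complex.I) * ((x t - y t : ℝ) : ℂ) =
      (2 * Real.pi * Complex.I) * ((z : ℝ) : ℂ) := by
    push_cast at hz ⊢
    linear_combination hz
  exact ⟨z, by exact_mod_cast mul_left_cancel₀ Complex.two_pi_I_ne_zero hmul⟩

theorem DistinctOnTorus.torusChar_injective (hp : DistinctOnTorus p) :
    Function.Injective fun i => torusChar (p i) := by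
  intro i j hij
  by_contra hne
  choose z hz using exists_int_sub_eq_of_torusChar_eq hij
  exact hp i j hne ⟨z, hz⟩

/-- The trigonometric sum `∑ i, x i * exp (2πi l·(p i))`: the Fourier coefficient at `-l` of the
measure with point masses `x i` at `p i`. -/
noncomputable def fourierSum (p : Fin n → Fin m → ℝ) (x : Fin n → ℝ) (l : Fin m → ℤ) : ℂ :=
  ∑ i, (x i : ℂ) * torusChar (p i) (Multiplicative.ofAdd l)

theorem normSq_fourierSum (p : Fin n → Fin m → ℝ) (x : Fin n → ℝ) (l : Fin m → ℤ) :
    Complex.normSq (fourierSum p x l) =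
      ∑ i, ∑ j, x i * (Real.cos (phase l (p i - p j)) * x j) := by
  have hre : (fourierSum p x l).re = ∑ i, x i * Real.cos (phase l (p i)) := by
    simp [fourierSum, torusChar_ofAdd, -Complex.ofReal_cos, -Complex.ofReal_sin]
  have him : (fourierSum p x l).im = ∑ i, x i * Real.sin (phase l (p i)) := by
    simp [fourierSum, torusChar_ofAdd, -Complex.ofReal_cos, -Complex.ofReal_sin]
  rw [Complex.normSq_apply, hre, him, Finset.sum_mul_sum, Finset.sum_mul_sum,
    ← Finset.sum_add_distrib]
  refine Finset.sum_congr rfl fun i _ => ?_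
  rw [← Finset.sum_add_distrib]
  refine Finset.sum_congr rfl fun j _ => ?_
  rw [phase_sub, Real.cos_sub]
  ring

theorem DistinctOnTorus.exists_fourierSum_ne_zero (hp : DistinctOnTorus p) {x : Fin n → ℝ}
    (hx : x ≠ 0) : ∃ l, fourierSum p x l ≠ 0 := by
  by_contra! hzero
  have hli := (linearIndependent_monoidHom (Multiplicative (Fin m → ℤ)) ℂ).comp _
    hp.torusChar_injective
  refine hx (funext fun i => ?_)
  have hxi := Fintype.linearIndependent_iff.1 hli (fun i => (x i : ℂ))
    (funext fun l => by simpa [fourierSum] using hzero l.toAdd) i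
  exact_mod_cast hxi

theorem hasSum_kernelG (hk : m < 2 * k) {lam : ℝ} (hlam : 0 < lam) (x : Fin m → ℝ) :
    HasSum (fun l : Fin m → ℤ => 1 / (1 + lam * powNorm k l) * Real.cos (phase l x))
      (kernelG k lam x) := by
  refine ((summable_one_div_one_add_mul_powNorm hk hlam).of_norm_bounded fun l => ?_).hasSum
  have hnorm := powNorm_nonneg k l
  rw [norm_mul, Real.norm_of_nonneg (by positivity)]
  exact mul_le_of_le_one_right (by positivity) (Real.abs_cos_le_one _)

theorem hasSum_dotProduct_matG_mulVec (hk : m < 2 * k) {lam : ℝ} (hlam : 0 < lam)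
    (p : Fin n → Fin m → ℝ) (x : Fin n → ℝ) :
    HasSum (fun l => 1 / (1 + lam * powNorm k l) * Complex.normSq (fourierSum p x l))
      (x ⬝ᵥ ((matG k p lam).mulVec x)) := by
  have hsum : HasSum (fun l : Fin m → ℤ => ∑ i, ∑ j,
      x i * (1 / (1 + lam * powNorm k l) * Real.cos (phase l (p i - p j)) * x j))
      (∑ i, ∑ j, x i * (kernelG k lam (p i - p j) * x j)) :=
    hasSum_sum fun i _ => hasSum_sum fun j _ =>
      ((hasSum_kernelG hk hlam (p i - p j)).mul_right (x j)).mul_left (x i)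
  convert hsum using 1
  · funext l
    simp only [normSq_fourierSum, Finset.mul_sum]
    exact Finset.sum_congr rfl fun i _ => Finset.sum_congr rfl fun j _ => by ring
  · simp only [dotProduct, Matrix.mulVec, matG, Matrix.of_apply, Finset.mul_sum]

theorem matG_posDef (hk : m < 2 * k) (hp : DistinctOnTorus p) {lam : ℝ} (hlam : 0 < lam) :
    (matG k p lam).PosDef := by
  refine Matrix.PosDef.of_dotProduct_mulVec_pos (matG_isHermitian k p lam) fun x hx => ?_
  obtain ⟨l, hl⟩ := hp.exists_fourierSum_ne_zero hx
  have hweight : ∀ l : Fin m → ℤ, 0 < 1 / (1 + lam * powNorm k l) := fun l => by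
    have := powNorm_nonneg k l
    positivity
  have hsum := hasSum_dotProduct_matG_mulVec hk hlam p x
  rw [star_trivial, ← hsum.tsum_eq]
  exact hsum.summable.tsum_pos (fun l => mul_nonneg (hweight l).le (Complex.normSq_nonneg _)) l
    (mul_pos (hweight l) (Complex.normSq_pos.2 hl))

theorem inv_mul_dotProduct_matG_one_le (hk : m < 2 * k) (p : Fin n → Fin m → ℝ) {lam : ℝ}
    (hlam : 1 ≤ lam) (x : Fin n → ℝ) :
    lam⁻¹ * (x ⬝ᵥ ((matG k p 1).mulVec x)) ≤ x ⬝ᵥ ((matG k p lam).mulVec x) := by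
  have hpos : 0 < lam := by linarith
  refine hasSum_le (fun l => ?_) ((hasSum_dotProduct_matG_mulVec hk one_pos p x).mul_left lam⁻¹)
    (hasSum_dotProduct_matG_mulVec hk hpos p x)
  have hnorm := powNorm_nonneg k l
  rw [← mul_assoc, one_div, one_div, ← mul_inv]
  refine mul_le_mul_of_nonneg_right (inv_anti₀ (by positivity) ?_) (Complex.normSq_nonneg _)
  linarith

theorem sq_card_le_dotProduct_matG_one (hk : m < 2 * k) (p : Fin n → Fin m → ℝ) {lam : ℝ}
    (hlam : 0 < lam) : (n : ℝ) ^ 2 ≤ 1 ⬝ᵥ ((matG k p lam).mulVec 1) := by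
  have hterm := le_hasSum (hasSum_dotProduct_matG_mulVec hk hlam p 1) 0 fun l _ =>
    mul_nonneg (by have := powNorm_nonneg k l; positivity) (Complex.normSq_nonneg _)
  have hk0 : k ≠ 0 := by omega
  simpa [normSq_fourierSum, phase_zero_left, powNorm_zero hk0, sq] using hterm

end FourierForm

section KernelAtInfinity

theorem analyticAt_tsum_mul_div_one_add {ι : Type*} {b w : ι → ℂ} {M : ℝ}
    (hbw : Summable fun l => ‖b l * w l‖) (hw : ∀ l, ‖w l‖ ≤ M) :
    AnalyticAt ℂ (fun z => ∑' l, b l * (z * w l / (1 + z * w l))) 0 := by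
  let r : ℝ := (2 * (|M| + 1))⁻¹
  have hden : ∀ l, ∀ z ∈ Metric.ball (0 : ℂ) r, 1 / 2 ≤ ‖1 + z * w l‖ := fun l z hz => by
    have hsmall : ‖z * w l‖ ≤ 1 / 2 := calc
      ‖z * w l‖ ≤ r * (|M| + 1) := by
        rw [norm_mul]
        have := (hw l).trans (le_abs_self M)
        gcongr
        · exact (mem_ball_zero_iff.1 hz).le
        · linarith
      _ = 1 / 2 := by simp only [r]; field_simp
    have htri := norm_sub_le_norm_add (1 : ℂ) (z * w l)
    rw [norm_one] at htri
    linarith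
  have hdiff : DifferentiableOn ℂ (fun z => ∑' l, b l * (z * w l / (1 + z * w l)))
      (Metric.ball 0 r) := by
    refine Complex.differentiableOn_tsum_of_summable_norm (hbw.mul_left (2 * r)) (fun l => ?_)
      Metric.isOpen_ball fun l z hz => ?_
    · refine ((differentiableOn_id.mul_const _).div
        ((differentiableOn_id.mul_const _).const_add _) fun z hz hzero => ?_).const_mul _
      have := hden l z hz
      norm_num [show 1 + z * w l = 0 from hzero] at this
    · have hpos : 0 < ‖1 + z * w l‖ := by linarith [hden l z hz]
      rw [mul_div_assoc', norm_div, div_le_iff₀ hpos]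
      calc ‖b l * (z * w l)‖ = ‖z‖ * ‖b l * w l‖ := by simp only [norm_mul]; ring
        _ ≤ r * ‖b l * w l‖ := by gcongr; exact (mem_ball_zero_iff.1 hz).le
        _ = 2 * r * ‖b l * w l‖ * (1 / 2) := by ring
        _ ≤ 2 * r * ‖b l * w l‖ * ‖1 + z * w l‖ := by gcongr; exact hden l z hz
  exact hdiff.analyticAt (Metric.ball_mem_nhds 0 (by positivity))

variable {m k : ℕ}

/-- The kernel as a function of `t = 1 / lam`, extended through `t = 0`. The constant `1` is the
term `l = 0` of the series, which the convention `0⁻¹ = 0` removes from the sum. -/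
noncomputable def kernelInv (k : ℕ) (x : Fin m → ℝ) (t : ℝ) : ℝ :=
  1 + ∑' l : Fin m → ℤ,
    Real.cos (phase l x) * (t * (powNorm k l)⁻¹ / (1 + t * (powNorm k l)⁻¹))

theorem kernelInv_zero (k : ℕ) (x : Fin m → ℝ) : kernelInv k x 0 = 1 := by
  simp [kernelInv]

theorem kernelInv_neg (k : ℕ) (x : Fin m → ℝ) (t : ℝ) :
    kernelInv k (-x) t = kernelInv k x t := by
  simp [kernelInv, phase_neg]

theorem kernelG_eq_kernelInv_inv (hk : m < 2 * k) {lam : ℝ} (hlam : 0 < lam) (x : Fin m → ℝ) :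
    kernelG k lam x = kernelInv k x lam⁻¹ := by
  have hk0 : k ≠ 0 := by omega
  have hsum := hasSum_kernelG hk hlam x
  rw [← hsum.tsum_eq, hsum.summable.tsum_eq_add_tsum_ite 0, kernelInv, phase_zero_left,
    powNorm_zero hk0, mul_zero, add_zero, Real.cos_zero, div_one, mul_one]
  congr 1
  refine tsum_congr fun l => ?_
  rcases eq_or_ne l 0 with rfl | hl
  · simp [powNorm_zero hk0]
  · have hnorm := one_le_powNorm k hl
    rw [if_neg hl]
    field_simp
    ring

theorem norm_inv_powNorm_le_one (hk : k ≠ 0) (l : Fin m → ℤ) : ‖(powNorm k l)⁻¹‖ ≤ 1 := by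
  rw [Real.norm_of_nonneg (inv_nonneg.2 (powNorm_nonneg k l))]
  rcases eq_or_ne l 0 with rfl | hl
  · rw [powNorm_zero hk, inv_zero]
    exact zero_le_one
  · exact inv_le_one_of_one_le₀ (one_le_powNorm k hl)

theorem kernelInv_eq_one_add_re (k : ℕ) (x : Fin m → ℝ) (t : ℝ) :
    kernelInv k x t = 1 + (∑' l : Fin m → ℤ, (Real.cos (phase l x) : ℂ) *
      ((t : ℂ) * ((powNorm k l)⁻¹ : ℝ) / (1 + (t : ℂ) * ((powNorm k l)⁻¹ : ℝ)))).re := by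
  rw [kernelInv, ← Complex.ofReal_re (∑' l, _), Complex.ofReal_tsum]
  push_cast
  rfl

theorem analyticAt_kernelInv (hk : m < 2 * k) (x : Fin m → ℝ) :
    AnalyticAt ℝ (kernelInv k x) 0 := by
  have hsum : Summable fun l : Fin m → ℤ =>
      ‖(Real.cos (phase l x) : ℂ) * ((powNorm k l)⁻¹ : ℝ)‖ := by
    refine (summable_inv_powNorm hk).norm.of_nonneg_of_le (fun l => norm_nonneg _) fun l => ?_
    rw [norm_mul, Complex.norm_real, Complex.norm_real]
    exact mul_le_of_le_one_left (norm_nonneg _) (Real.abs_cos_le_one _)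
  have hcomplex := analyticAt_tsum_mul_div_one_add hsum fun l => by
    rw [Complex.norm_real]
    exact norm_inv_powNorm_le_one (by omega) l
  rw [← Complex.ofReal_zero] at hcomplex
  rw [funext (kernelInv_eq_one_add_re k x)]
  exact analyticAt_const.add hcomplex.re_ofReal

end KernelAtInfinity

section ExpansionAtInfinity

variable {f : ℝ → ℝ} {a : ℕ → ℝ}

theorem HasExpansionAtInfinity.exists_abs_sub_le (h : HasExpansionAtInfinity f a) :
    ∃ K : ℝ, ∀ᶠ lam : ℝ in atTop, |f lam - a 0 - a 1 / lam| ≤ K / lam ^ 2 := by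
  obtain ⟨lam₀, h₀, hpos₀⟩ := (h.and (eventually_gt_atTop 0)).exists
  have hsum : Summable fun r => |a (r + 2)| / lam₀ ^ r := by
    refine (((summable_nat_add_iff 2).2 h₀.summable).abs.mul_left (lam₀ ^ 2)).congr fun r => ?_
    rw [abs_div, abs_of_pos (pow_pos hpos₀ _), pow_add]
    field_simp
  refine ⟨∑' r, |a (r + 2)| / lam₀ ^ r, ?_⟩
  filter_upwards [h, eventually_ge_atTop lam₀] with lam hlam hle
  have hpos : 0 < lam := hpos₀.trans_le hle
  have htail : HasSum (fun r => a (r + 2) / lam ^ (r + 2)) (f lam - a 0 - a 1 / lam) := by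
    simpa [Finset.sum_range_succ, sub_sub] using (hasSum_nat_add_iff' 2).2 hlam
  rw [← htail.tsum_eq, ← Real.norm_eq_abs]
  refine tsum_of_norm_bounded (hsum.hasSum.div_const (lam ^ 2)) fun r => ?_
  rw [Real.norm_eq_abs, abs_div, abs_of_pos (pow_pos hpos _), pow_add, div_mul_eq_div_div]
  gcongr

theorem HasExpansionAtInfinity.tendsto_mul_sub (h : HasExpansionAtInfinity f a) :
    Tendsto (fun lam => lam * (f lam - a 0)) atTop (𝓝 (a 1)) := by
  obtain ⟨K, hK⟩ := h.exists_abs_sub_le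
  rw [← tendsto_sub_nhds_zero_iff]
  refine squeeze_zero_norm' (a := fun lam => K / lam) ?_ (tendsto_const_nhds.div_atTop tendsto_id)
  filter_upwards [hK, eventually_gt_atTop 0] with lam hbound hpos
  calc ‖lam * (f lam - a 0) - a 1‖ = lam * |f lam - a 0 - a 1 / lam| := by
        rw [← abs_of_pos hpos, ← abs_mul, abs_of_pos hpos, mul_sub _ _ (a 1 / lam),
          mul_div_cancel₀ _ hpos.ne', Real.norm_eq_abs]
    _ ≤ lam * (K / lam ^ 2) := by gcongr
    _ = K / lam := by field_simp

theorem HasExpansionAtInfinity.tendsto (h : HasExpansionAtInfinity f a) :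
    Tendsto f atTop (𝓝 (a 0)) := by
  rw [← tendsto_sub_nhds_zero_iff]
  have hprod := h.tendsto_mul_sub.mul tendsto_inv_atTop_zero
  rw [mul_zero] at hprod
  refine hprod.congr' ?_
  filter_upwards [eventually_gt_atTop 0] with lam hlam
  field_simp

theorem exists_hasExpansionAtInfinity {g : ℝ → ℝ} (hg : AnalyticAt ℝ g 0)
    (hfg : ∀ᶠ t in 𝓝[>] 0, f t⁻¹ = g t) : ∃ a, HasExpansionAtInfinity f a := by
  obtain ⟨q, hq⟩ := hg
  have hsum : ∀ᶠ t in 𝓝[>] (0 : ℝ), HasSum (fun r => q.coeff r / t⁻¹ ^ r) (f t⁻¹) := by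
    filter_upwards [hfg, nhdsWithin_le_nhds hq.eventually_hasSum] with t hft hgt
    rw [hft]
    simpa [div_eq_mul_inv, mul_comm] using hgt
  refine ⟨q.coeff, (tendsto_inv_atTop_nhdsGT_zero.eventually hsum).mono fun lam hlam => ?_⟩
  simpa using hlam

end ExpansionAtInfinity

section Rho

variable {m n k : ℕ} {p : Fin n → Fin m → ℝ}

theorem exists_hasExpansionAtInfinity_rho (hk : m < 2 * k) (p : Fin n → Fin m → ℝ) (l : Fin n) :
    ∃ a, HasExpansionAtInfinity (rho k p l) a := by
  let H : ℝ → Matrix (Fin n) (Fin n) ℝ := fun t => Matrix.of fun i j => kernelInv k (p i - p j) t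
  have hherm : ∀ t, (H t).IsHermitian := fun t => by
    ext i j
    simp only [Matrix.conjTranspose_apply, H, Matrix.of_apply, star_trivial]
    rw [← kernelInv_neg, neg_sub]
  have hmatG : ∀ t, 0 < t → matG k p t⁻¹ = H t := fun t ht => by
    ext i j
    simp only [matG, H, Matrix.of_apply]
    rw [kernelG_eq_kernelInv_inv hk (inv_pos.2 ht), inv_inv]
  obtain ⟨f, hf, hfeq⟩ := exists_analyticAt_eventually_eigenvalues₀_eq (H := H)
    (fun i j => analyticAt_kernelInv hk (p i - p j)) hherm
  refine exists_hasExpansionAtInfinity (hf (Fin.cast (Fintype.card_fin n).symm l)) ?_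
  filter_upwards [hfeq, self_mem_nhdsWithin] with t ht hpos
  rw [← ht]
  simp only [rho, hmatG t hpos]

theorem antitone_rho (k : ℕ) (p : Fin n → Fin m → ℝ) (lam : ℝ) :
    Antitone fun l => rho k p l lam := fun _ _ hij =>
  (matG_isHermitian k p lam).eigenvalues₀_antitone hij

theorem sum_rho (hk : m < 2 * k) (p : Fin n → Fin m → ℝ) {lam : ℝ} (hlam : 0 < lam) :
    ∑ l, rho k p l lam = n * kernelInv k (0 : Fin m → ℝ) lam⁻¹ := by
  have htrace := trace_eq_sum_eigenvalues₀ (matG_isHermitian k p lam)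
  simp only [RCLike.ofReal_real_eq_id, id_eq] at htrace
  calc ∑ l, rho k p l lam = (matG k p lam).trace := by
        rw [htrace]
        exact Equiv.sum_comp (finCongr (Fintype.card_fin n).symm) _
    _ = _ := by simp [Matrix.trace, matG, kernelG_eq_kernelInv_inv hk hlam]

theorem exists_pos_le_mul_rho (hk : m < 2 * k) (hp : DistinctOnTorus p) :
    ∃ c : ℝ, 0 < c ∧ ∀ lam : ℝ, 1 ≤ lam → ∀ l, c ≤ lam * rho k p l lam := by
  obtain ⟨c, hc, hle⟩ := exists_pos_forall_le_eigenvalues₀ (matG_posDef hk hp one_pos)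
  have hform := (forall_le_eigenvalues₀_iff _).1 hle
  refine ⟨c, hc, fun lam hlam l => ?_⟩
  have hpos : 0 < lam := by linarith
  rw [← inv_mul_le_iff₀ hpos]
  refine (forall_le_eigenvalues₀_iff (matG_isHermitian k p lam)).2 (fun x => ?_) _
  rw [mul_assoc]
  exact (mul_le_mul_of_nonneg_left (hform x) (inv_nonneg.2 hpos.le)).trans
    (inv_mul_dotProduct_matG_one_le hk p hlam x)

theorem rho_nonneg (hk : m < 2 * k) (hp : DistinctOnTorus p) {lam : ℝ} (hlam : 0 < lam)
    (l : Fin n) : 0 ≤ rho k p l lam := by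
  obtain ⟨c, hc, hle⟩ := exists_pos_forall_le_eigenvalues₀ (matG_posDef hk hp hlam)
  exact hc.le.trans (hle _)

theorem card_le_rho_zero [NeZero n] (hk : m < 2 * k) (p : Fin n → Fin m → ℝ) {lam : ℝ}
    (hlam : 0 < lam) : (n : ℝ) ≤ rho k p 0 lam := by
  have hform := (forall_eigenvalues₀_le_iff (matG_isHermitian k p lam)).1
    (fun l => antitone_rho k p lam (Fin.zero_le (Fin.cast (Fintype.card_fin n) l))) 1
  have hones := sq_card_le_dotProduct_matG_one hk p hlam
  have hn : (0 : ℝ) < n := by exact_mod_cast NeZero.pos n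
  simp only [star_one, one_dotProduct_one, Fintype.card_fin, RCLike.natCast_re,
    RCLike.re_to_real] at hform
  nlinarith

theorem tendsto_sum_rho (hk : m < 2 * k) (p : Fin n → Fin m → ℝ) :
    Tendsto (fun lam => ∑ l, rho k p l lam) atTop (𝓝 n) := by
  have hkernel := (analyticAt_kernelInv hk (0 : Fin m → ℝ)).continuousAt.tendsto.comp
    tendsto_inv_atTop_zero
  rw [kernelInv_zero] at hkernel
  have hmul := hkernel.const_mul (n : ℝ)
  rw [mul_one] at hmul
  exact hmul.congr' ((eventually_gt_atTop 0).mono fun lam hlam => (sum_rho hk p hlam).symm)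

theorem tendsto_rho_zero [NeZero n] (hk : m < 2 * k) (hp : DistinctOnTorus p) :
    Tendsto (rho k p 0) atTop (𝓝 n) := by
  refine tendsto_of_tendsto_of_tendsto_of_le_of_le' tendsto_const_nhds (tendsto_sum_rho hk p)
    ((eventually_gt_atTop 0).mono fun lam hlam => card_le_rho_zero hk p hlam)
    ((eventually_gt_atTop 0).mono fun lam hlam => ?_)
  exact Finset.single_le_sum (f := fun l => rho k p l lam)
    (fun i _ => rho_nonneg hk hp hlam i) (Finset.mem_univ 0)

theorem tendsto_rho_of_ne_zero [NeZero n] (hk : m < 2 * k) (hp : DistinctOnTorus p) {l : Fin n}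
    (hl : l ≠ 0) : Tendsto (rho k p l) atTop (𝓝 0) := by
  have hdiff := (tendsto_sum_rho hk p).sub (tendsto_rho_zero hk hp)
  rw [sub_self] at hdiff
  refine tendsto_of_tendsto_of_tendsto_of_le_of_le' tendsto_const_nhds hdiff
    ((eventually_gt_atTop 0).mono fun lam hlam => rho_nonneg hk hp hlam l)
    ((eventually_gt_atTop 0).mono fun lam hlam => ?_)
  rw [le_sub_iff_add_le]
  exact Finset.add_le_sum (f := fun l => rho k p l lam) (s := Finset.univ)
    (fun i _ => rho_nonneg hk hp hlam i) (Finset.mem_univ l) (Finset.mem_univ 0) hl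

end Rho

theorem mainTheorem5 (m n k : ℕ) (hk : (m : ℝ) / 2 < (k : ℝ))
    (p : Fin n → Fin m → ℝ) (hp : DistinctOnTorus p) :
    (∀ lam : ℝ, 0 < lam → (matG k p lam).PosDef) ∧
    (∀ l : Fin n, ∃ a : ℕ → ℝ, HasExpansionAtInfinity (rho k p l) a) ∧
    (∀ (l : Fin n) (a : ℕ → ℝ), HasExpansionAtInfinity (rho k p l) a →
      a 0 = (if (l : ℕ) = 0 then (n : ℝ) else 0) ∧ (1 ≤ (l : ℕ) → 0 < a 1)) := by
  have hk' : m < 2 * k := by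
    have : (m : ℝ) < 2 * k := by linarith
    exact_mod_cast this
  refine ⟨fun lam hlam => matG_posDef hk' hp hlam, exists_hasExpansionAtInfinity_rho hk' p,
    fun l a ha => ?_⟩
  have : NeZero n := ⟨(Fin.pos l).ne'⟩
  rcases eq_or_ne l 0 with rfl | hl
  · rw [Fin.val_zero]
    exact ⟨tendsto_nhds_unique ha.tendsto (tendsto_rho_zero hk' hp), by simp⟩
  · have ha0 : a 0 = 0 := tendsto_nhds_unique ha.tendsto (tendsto_rho_of_ne_zero hk' hp hl)
    rw [if_neg (Fin.val_ne_zero_iff.2 hl)]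
    refine ⟨ha0, fun _ => ?_⟩
    obtain ⟨c, hc, hle⟩ := exists_pos_le_mul_rho hk' hp
    refine hc.trans_le (ge_of_tendsto ha.tendsto_mul_sub ?_)
    filter_upwards [eventually_ge_atTop 1] with lam hlam
    rw [ha0, sub_zero]
    exact hle lam hlam l
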